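/- Let $\gamma:[0,1]\to(0,\infty)$ be a deterministic càdlàg function that is not constant on $[0,1)$, let $\sigma^2=\int_0^1\gamma_t^2\,dt$, and let $\varepsilon>0$. Write $a(y)=\sigma^2(1-\sqrt y)^2$ and $b(y)=\sigma^2(1+\sqrt y)^2$. Then there is a constant $y_c=y_c(\gamma,\varepsilon)>0$ such that the following holds. On a common probability space let, for every $p$, $\mathbf W^{(p)}$ be a standard $p$-dimensional Brownian motion (with no assumption on the joint law for different $p$), and let $\mathbf X^{(p)}$ be a $p$-dimensional process with $d\mathbf X^{(p)}_t=\gamma_t\,d\mathbf W^{(p)}_t$, $t\in[0,1]$. Let $n=n(p)$ be such that $p/n\to y$ as $p\to\infty$ for some real $y\ge y_c$. Let $$\Sigma^{\mathrm{RCV}}_p=\sum_{\ell=1}^n \Delta\mathbf X_\ell(\Delta\mathbf X_\ell)^T,\qquad \Delta\mathbf X_\ell=\mathbf X^{(p)}_{\ell/n}-\mathbf X^{(p)}_{(\ell-1)/n},$$ be the realized covariance matrix from equally spaced observations, and let $F^{\Sigma^{\mathrm{RCV}}_p}(x)=\frac1p\#\{j:\lambda_j\le x\}$ be its empirical spectral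 distribution, where $\lambda_1,\dots,\lambda_p$ are its eigenvalues counted with multiplicity. Then $$\limsup_{p\to\infty}F^{\Sigma^{\mathrm{RCV}}_p}\bigl(b(y)+\sigma^2\varepsilon\bigr)<1\quad\text{almost surely.}$$ In particular, almost surely, $F^{\Sigma^{\mathrm{RCV}}_p}$ does not converge in distribution to the Marčenko–Pastur law $\mathrm{MP}^{(y,\sigma^2)}$, which has density $\frac{1}{2\pi\sigma^2xy}\sqrt{(b(y)-x)(x-a(y))}$ on $[a(y),b(y)]$ and, if $y>1$, a point mass $1-1/y$ at the origin. -/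

import Mathlib

open MeasureTheory ProbabilityTheory Filter Topology
open scoped NNReal ENNReal BoundedContinuousFunction

/-- `γ` is càdlàg on `[0, 1]`: right-continuous on `[0, 1)` with (finite) left limits on `(0, 1]`. -/
def CadlagOnUnitInterval (γ : ℝ → ℝ) : Prop :=
  (∀ t ∈ Set.Ico (0 : ℝ) 1, ContinuousWithinAt γ (Set.Ici t) t) ∧
    ∀ t ∈ Set.Ioc (0 : ℝ) 1, ∃ l : ℝ, Tendsto γ (𝓝[<] t) (𝓝 l)

/-- A deterministic step function `∑ i, a i • 1_{(u i, v i]}` on `[0, ∞)`. -/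
structure StepFunction where
  /-- number of intervals -/
  m : ℕ
  /-- values -/
  a : Fin m → ℝ
  /-- left endpoints -/
  u : Fin m → ℝ≥0
  /-- right endpoints -/
  v : Fin m → ℝ≥0
  le : ∀ i, u i ≤ v i

/-- The real function given by a step function. -/
noncomputable def StepFunction.toFun (g : StepFunction) (s : ℝ) : ℝ :=
  ∑ i, (Set.Ioc (g.u i : ℝ) (g.v i : ℝ)).indicator (fun _ => g.a i) s

/-- The elementary integral `∑ i, a i (B_{v i} - B_{u i})` of a step function against `B`. -/
noncomputable def StepFunction.integral {Ω : Type*} (g : StepFunction) (B : ℝ≥0 → Ω → ℝ)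
    (ω : Ω) : ℝ :=
  ∑ i, g.a i * (B (g.v i) ω - B (g.u i) ω)

/-- `Y` is (a version of) the stochastic integral `∫ f dB` of the deterministic square-integrable
function `f` against the Brownian motion `B`: the `L²(P)`-limit of the elementary integrals of step
functions which converge to `f` in `L²(ds)`. By the Itô isometry the limit does not depend on the
approximating sequence, so `Y` is determined up to almost sure equality. -/
def IsWienerIntegral {Ω : Type*} [MeasurableSpace Ω] (P : Measure Ω) (B : ℝ≥0 → Ω → ℝ)
    (f : ℝ → ℝ) (Y : Ω → ℝ) : Prop :=
  MemLp f 2 (volume : Measure ℝ) ∧ MemLp Y 2 P ∧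
    ∃ g : ℕ → StepFunction,
      Tendsto (fun k => eLpNorm (fun s => (g k).toFun s - f s) 2 (volume : Measure ℝ))
        atTop (𝓝 0) ∧
      Tendsto (fun k => eLpNorm (fun ω => (g k).integral B ω - Y ω) 2 P) atTop (𝓝 0)

/-- `W` is a standard `p`-dimensional Brownian motion (`W j t ω` is its `j`-th coordinate at
time `t`): the coordinates are independent standard real Brownian motions. -/
def IsStandardBrownianMotion {Ω : Type*} [MeasurableSpace Ω] (P : Measure Ω) {p : ℕ}
    (W : Fin p → ℝ≥0 → Ω → ℝ) : Prop :=
  (∀ j, IsBrownianReal (W j) P) ∧ iIndepFun (fun j ω t => W j t ω) P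

/-- `X` satisfies `dX_t = γ_t dW_t` on `[0, 1]`, with `γ` a deterministic scalar function:
coordinatewise and for each `t ∈ [0, 1]`, `X_t - X_0 = ∫_0^t γ_s dW_s` almost surely.
Every version of the process `X` is allowed; path continuity is not required. -/
def SatisfiesScalarSDE {Ω : Type*} [MeasurableSpace Ω] (P : Measure Ω) (γ : ℝ → ℝ) {p : ℕ}
    (W : Fin p → ℝ≥0 → Ω → ℝ) (X : ℝ≥0 → Ω → Fin p → ℝ) : Prop :=
  ∀ (j : Fin p) (t : ℝ≥0), t ≤ 1 →
    IsWienerIntegral P (W j) ((Set.Ioc (0 : ℝ) (t : ℝ)).indicator γ)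
      (fun ω => X t ω j - X 0 ω j)

/-- The realized covariance matrix `∑_{ℓ=1}^n Δx_ℓ (Δx_ℓ)ᵀ`, `Δx_ℓ = x(τ_ℓ) - x(τ_{ℓ-1})`,
of a path `x` observed at the times `τ_0, …, τ_n`. -/
noncomputable def rcv {p : ℕ} (n : ℕ) (τ : ℕ → ℝ≥0) (x : ℝ≥0 → Fin p → ℝ) :
    Matrix (Fin p) (Fin p) ℝ :=
  ∑ l ∈ Finset.range n,
    Matrix.vecMulVec (x (τ (l + 1)) - x (τ l)) (x (τ (l + 1)) - x (τ l))

theorem rcv_isHermitian {p : ℕ} (n : ℕ) (τ : ℕ → ℝ≥0) (x : ℝ≥0 → Fin p → ℝ) :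
    (rcv n τ x).IsHermitian := by
  refine Matrix.IsHermitian.ext fun i j => ?_
  simp [rcv, Matrix.sum_apply, Matrix.vecMulVec_apply, mul_comm]

/-- The equally spaced observation times `τ_{n,ℓ} = ℓ / n`. -/
noncomputable def equallySpaced (n : ℕ) (l : ℕ) : ℝ≥0 := (l : ℝ≥0) / (n : ℝ≥0)

open scoped Classical in
/-- The empirical spectral distribution function `F^A(x) = #{j : λ_j ≤ x} / p` of a symmetric
`p × p` matrix `A`, the eigenvalues `λ_j` being counted with multiplicity. -/
noncomputable def esd {p : ℕ} {A : Matrix (Fin p) (Fin p) ℝ} (hA : A.IsHermitian) (x : ℝ) : ℝ :=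
  ((Finset.univ.filter fun j : Fin p => hA.eigenvalues j ≤ x).card : ℝ) / (p : ℝ)

/-- The empirical spectral distribution as a measure, `(1 / p) ∑ j, δ_{λ_j}`; its distribution
function is `esd hA`. -/
noncomputable def esdMeasure {p : ℕ} {A : Matrix (Fin p) (Fin p) ℝ} (hA : A.IsHermitian) :
    Measure ℝ :=
  ((p : ℝ≥0∞)⁻¹) • ∑ j : Fin p, Measure.dirac (hA.eigenvalues j)

/-- Left edge `a(y) = s (1 - √y)²` of the Marčenko–Pastur law with scale index `s`. -/
noncomputable def mpLeft (y s : ℝ) : ℝ := s * (1 - √y) ^ 2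

/-- Right edge `b(y) = s (1 + √y)²` of the Marčenko–Pastur law with scale index `s`. -/
noncomputable def mpRight (y s : ℝ) : ℝ := s * (1 + √y) ^ 2

/-- The Marčenko–Pastur law `MP^{(y, s)}` with ratio index `y > 0` and scale index `s > 0`:
density `√((b - x)(x - a)) / (2 π s x y)` on `[a, b]`, plus, if `y > 1`, a point mass `1 - 1/y`
at the origin (`ENNReal.ofReal (1 - 1 / y)` vanishes for `0 < y ≤ 1`). -/
noncomputable def marchenkoPastur (y s : ℝ) : Measure ℝ :=
  (volume.withDensity fun x => ENNReal.ofReal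
    ((Set.Icc (mpLeft y s) (mpRight y s)).indicator
      (fun x => √((mpRight y s - x) * (x - mpLeft y s)) / (2 * Real.pi * s * x * y)) x)) +
  ENNReal.ofReal (1 - 1 / y) • Measure.dirac 0

/-- Convergence in distribution (weak convergence) of a sequence of laws on `ℝ`. -/
def ConvergesInDistribution (μ : ℕ → Measure ℝ) (ν : Measure ℝ) : Prop :=
  ∀ f : ℝ →ᵇ ℝ, Tendsto (fun k => ∫ x, f x ∂(μ k)) atTop (𝓝 (∫ x, f x ∂ν))

/-! ### Linearity of the Wiener integral -/

/-- The sum of two step functions. -/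
def StepFunction.add (g h : StepFunction) : StepFunction where
  m := g.m + h.m
  a := Fin.append g.a h.a
  u := Fin.append g.u h.u
  v := Fin.append g.v h.v
  le i := by
    refine Fin.addCases (fun i => ?_) (fun i => ?_) i
    · simpa using g.le i
    · simpa using h.le i

/-- A scalar multiple of a step function. -/
def StepFunction.smul (c : ℝ) (g : StepFunction) : StepFunction where
  m := g.m
  a i := c * g.a i
  u := g.u
  v := g.v
  le := g.le

/-- The step function without intervals. -/
def StepFunction.empty : StepFunction where
  m := 0
  a := Fin.elim0
  u := Fin.elim0
  v := Fin.elim0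
  le i := i.elim0

theorem StepFunction.add_toFun (g h : StepFunction) (s : ℝ) :
    (g.add h).toFun s = g.toFun s + h.toFun s := by
  refine (Fin.sum_univ_add (a := g.m) (b := h.m) _).trans ?_
  simp only [StepFunction.toFun, StepFunction.add, Fin.append_left, Fin.append_right]

theorem StepFunction.add_integral {Ω : Type*} (g h : StepFunction) (B : ℝ≥0 → Ω → ℝ) (ω : Ω) :
    (g.add h).integral B ω = g.integral B ω + h.integral B ω := by
  refine (Fin.sum_univ_add (a := g.m) (b := h.m) _).trans ?_
  simp only [StepFunction.integral, StepFunction.add, Fin.append_left, Fin.append_right]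

theorem StepFunction.smul_toFun (c : ℝ) (g : StepFunction) (s : ℝ) :
    (g.smul c).toFun s = c * g.toFun s := by
  simp only [StepFunction.toFun, StepFunction.smul, Finset.mul_sum]
  refine Finset.sum_congr rfl fun i _ => ?_
  by_cases h : s ∈ Set.Ioc (g.u i : ℝ) (g.v i : ℝ) <;> simp [h]

theorem StepFunction.smul_integral {Ω : Type*} (c : ℝ) (g : StepFunction) (B : ℝ≥0 → Ω → ℝ)
    (ω : Ω) : (g.smul c).integral B ω = c * g.integral B ω := by
  simp only [StepFunction.integral, StepFunction.smul, Finset.mul_sum, mul_assoc]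
  rfl

theorem StepFunction.memLp (g : StepFunction) : MemLp g.toFun 2 (volume : Measure ℝ) := by
  unfold StepFunction.toFun
  refine memLp_finsetSum _ fun i _ => ?_
  exact memLp_indicator_const 2 measurableSet_Ioc _ (Or.inr (by simp))

section Wiener

variable {Ω : Type*} [MeasurableSpace Ω] {P : Measure Ω} {B : ℝ≥0 → Ω → ℝ}

theorem IsBrownianReal.memLp [IsProbabilityMeasure P] (hB : IsBrownianReal B P) (t : ℝ≥0) :
    MemLp (B t) 2 P :=
  (hB.toIsPreBrownianReal.isGaussianProcess.hasGaussianLaw_eval t).memLp_two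

theorem StepFunction.memLp_integral [IsProbabilityMeasure P] (hB : IsBrownianReal B P)
    (g : StepFunction) : MemLp (g.integral B) 2 P := by
  unfold StepFunction.integral
  refine memLp_finsetSum _ fun i _ => ?_
  exact ((IsBrownianReal.memLp hB _).sub (IsBrownianReal.memLp hB _)).const_mul _

theorem tendsto_eLpNorm_add {α : Type*} [MeasurableSpace α] {μ : Measure α} {G H : ℕ → α → ℝ}
    (hGm : ∀ k, AEStronglyMeasurable (G k) μ) (hHm : ∀ k, AEStronglyMeasurable (H k) μ)
    (hG : Tendsto (fun k => eLpNorm (G k) 2 μ) atTop (𝓝 0))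
    (hH : Tendsto (fun k => eLpNorm (H k) 2 μ) atTop (𝓝 0)) :
    Tendsto (fun k => eLpNorm (G k + H k) 2 μ) atTop (𝓝 0) := by
  refine tendsto_of_tendsto_of_tendsto_of_le_of_le tendsto_const_nhds (by simpa using hG.add hH)
    (fun k => zero_le) (fun k => ?_)
  exact eLpNorm_add_le (hGm k) (hHm k) (by norm_num)

theorem IsWienerIntegral.add [IsProbabilityMeasure P] (hB : IsBrownianReal B P)
    {f f' : ℝ → ℝ} {Y Y' : Ω → ℝ} (h : IsWienerIntegral P B f Y) (h' : IsWienerIntegral P B f' Y') :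
    IsWienerIntegral P B (fun s => f s + f' s) (fun ω => Y ω + Y' ω) := by
  obtain ⟨hf, hY, g, hg, hgi⟩ := h
  obtain ⟨hf', hY', g', hg', hgi'⟩ := h'
  refine ⟨hf.add hf', hY.add hY', fun k => (g k).add (g' k), ?_, ?_⟩
  · convert tendsto_eLpNorm_add (fun k => ((g k).memLp.sub hf).1)
      (fun k => ((g' k).memLp.sub hf').1) hg hg' using 3 with k
    ext s
    simp [StepFunction.add_toFun]; ring
  · convert tendsto_eLpNorm_add (fun k => (((g k).memLp_integral hB).sub hY).1)
      (fun k => (((g' k).memLp_integral hB).sub hY').1) hgi hgi' using 3 with k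
    ext s
    simp [StepFunction.add_integral]; ring

theorem tendsto_eLpNorm_const_smul {α : Type*} [MeasurableSpace α] {μ : Measure α} (c : ℝ)
    {G : ℕ → α → ℝ} (hG : Tendsto (fun k => eLpNorm (G k) 2 μ) atTop (𝓝 0)) :
    Tendsto (fun k => eLpNorm (c • G k) 2 μ) atTop (𝓝 0) := by
  simp only [eLpNorm_const_smul]
  simpa using ENNReal.Tendsto.const_mul hG (Or.inr (by simp : ‖c‖ₑ ≠ ⊤))

theorem IsWienerIntegral.const_mul (c : ℝ) {f : ℝ → ℝ} {Y : Ω → ℝ}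
    (h : IsWienerIntegral P B f Y) :
    IsWienerIntegral P B (fun s => c * f s) (fun ω => c * Y ω) := by
  obtain ⟨hf, hY, g, hg, hgi⟩ := h
  refine ⟨hf.const_mul c, hY.const_mul c, fun k => (g k).smul c, ?_, ?_⟩
  · convert tendsto_eLpNorm_const_smul c hg using 3 with k
    ext s
    simp [StepFunction.smul_toFun]; ring
  · convert tendsto_eLpNorm_const_smul c hgi using 3 with k
    ext s
    simp [StepFunction.smul_integral]; ring

theorem isWienerIntegral_zero : IsWienerIntegral P B (fun _ => 0) (fun _ => 0) := by
  refine ⟨MemLp.zero, MemLp.zero, fun _ => StepFunction.empty, ?_, ?_⟩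
  · simp [StepFunction.toFun, StepFunction.empty]
  · simp [StepFunction.integral, StepFunction.empty]

theorem IsWienerIntegral.sum [IsProbabilityMeasure P] (hB : IsBrownianReal B P) {ι : Type*}
    (s : Finset ι) {f : ι → ℝ → ℝ} {Y : ι → Ω → ℝ}
    (h : ∀ i, IsWienerIntegral P B (f i) (Y i)) :
    IsWienerIntegral P B (fun t => ∑ i ∈ s, f i t) (fun ω => ∑ i ∈ s, Y i ω) := by
  classical
  induction s using Finset.induction_on with
  | empty => simpa using isWienerIntegral_zero
  | insert i s hi ih =>
    simp only [Finset.sum_insert hi]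
    exact (h i).add hB ih

end Wiener

/-! ### The law of the Wiener integral -/

section WienerLaw

variable {Ω : Type*} [MeasurableSpace Ω] {P : Measure Ω}

theorem integral_indicator_Ioc_mul_indicator_Ioc (a a' : ℝ) {u v u' v' : ℝ≥0} (h : u ≤ v)
    (h' : u' ≤ v') :
    ∫ s : ℝ, (Set.Ioc (u : ℝ) v).indicator (fun _ => a) s *
        (Set.Ioc (u' : ℝ) v').indicator (fun _ => a') s =
      a * a' * ((min v v' : ℝ≥0) - (min v u' : ℝ≥0) - (min u v' : ℝ≥0) + (min u u' : ℝ≥0)) := by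
  have : ∀ s : ℝ, (Set.Ioc (u : ℝ) v).indicator (fun _ => a) s *
      (Set.Ioc (u' : ℝ) v').indicator (fun _ => a') s =
      (Set.Ioc (max (u : ℝ) u') (min (v : ℝ) v')).indicator (fun _ => a * a') s := by
    intro s
    rw [← Set.Ioc_inter_Ioc, Set.inter_indicator_mul]
  simp only [this]
  rw [integral_indicator_const _ measurableSet_Ioc, smul_eq_mul, mul_comm]
  congr 1
  simp only [Measure.real, Real.volume_Ioc, ENNReal.toReal_ofReal']
  have h1 : (u : ℝ) ≤ v := h
  have h2 : (u' : ℝ) ≤ v' := h'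
  push_cast
  grind

theorem StepFunction.integral_sq_toFun (g : StepFunction) :
    ∫ s, g.toFun s ^ 2 = ∑ i, ∑ j, g.a i * g.a j *
      ((min (g.v i) (g.v j) : ℝ≥0) - (min (g.v i) (g.u j) : ℝ≥0) - (min (g.u i) (g.v j) : ℝ≥0)
        + (min (g.u i) (g.u j) : ℝ≥0)) := by
  have hL : ∀ i, MemLp ((Set.Ioc (g.u i : ℝ) (g.v i : ℝ)).indicator (fun _ => g.a i)) 2 volume :=
    fun i => memLp_indicator_const 2 measurableSet_Ioc _ (Or.inr (by simp))
  simp only [StepFunction.toFun, sq, Finset.sum_mul_sum]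
  have hI : ∀ i j, Integrable (fun s => (Set.Ioc (g.u i : ℝ) (g.v i : ℝ)).indicator
      (fun _ => g.a i) s * (Set.Ioc (g.u j : ℝ) (g.v j : ℝ)).indicator (fun _ => g.a j) s) :=
    fun i j => (hL i).integrable_mul (hL j)
  rw [integral_finsetSum _ fun i _ => integrable_finsetSum _ fun j _ => hI i j]
  refine Finset.sum_congr rfl fun i _ => ?_
  rw [integral_finsetSum _ fun j _ => hI i j]
  exact Finset.sum_congr rfl fun j _ =>
    integral_indicator_Ioc_mul_indicator_Ioc _ _ (g.le i) (g.le j)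

theorem StepFunction.hasLaw_integral [IsProbabilityMeasure P] {B : ℝ≥0 → Ω → ℝ}
    (hB : IsBrownianReal B P) (g : StepFunction) :
    HasLaw (g.integral B) (gaussianReal 0 (∫ s, g.toFun s ^ 2).toNNReal) P := by
  have hG := hB.toIsPreBrownianReal.isGaussianProcess
  have hD : IsGaussianProcess (fun (i : Fin g.m) ω => g.a i * (B (g.v i) ω - B (g.u i) ω)) P := by
    classical
    exact hG.of_isGaussianProcess fun i => ⟨{g.v i, g.u i},
      { toFun x := g.a i * (x ⟨g.v i, by simp⟩ - x ⟨g.u i, by simp⟩)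
        map_add' x y := by simp; ring
        map_smul' c x := by simp; ring }, by simp⟩
  have hS : HasGaussianLaw (g.integral B) P := hD.hasGaussianLaw_fun_sum (I := Finset.univ)
  have hm : ∀ i, MemLp (fun ω => g.a i * (B (g.v i) ω - B (g.u i) ω)) 2 P := fun i =>
    ((IsBrownianReal.memLp hB _).sub (IsBrownianReal.memLp hB _)).const_mul _
  have hint : ∀ t, Integrable (B t) P := fun t => hB.toIsPreBrownianReal.integrable_eval t
  refine ⟨hS.aemeasurable, ?_⟩
  rw [hS.map_eq_gaussianReal]
  have h0 : P[g.integral B] = 0 := by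
    unfold StepFunction.integral
    rw [integral_finsetSum _ fun i _ => (hm i).integrable (by norm_num)]
    refine Finset.sum_eq_zero fun i _ => ?_
    rw [integral_const_mul, integral_sub (hint _) (hint _), hB.toIsPreBrownianReal.integral_eval,
      hB.toIsPreBrownianReal.integral_eval]
    simp
  have hv : Var[g.integral B; P] = ∫ s, g.toFun s ^ 2 := by
    rw [← covariance_self hS.aemeasurable, g.integral_sq_toFun]
    unfold StepFunction.integral
    rw [covariance_fun_sum_fun_sum hm hm]
    refine Finset.sum_congr rfl fun i _ => Finset.sum_congr rfl fun j _ => ?_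
    rw [covariance_const_mul_left, covariance_const_mul_right, covariance_fun_sub_fun_sub
      (IsBrownianReal.memLp hB _) (IsBrownianReal.memLp hB _) (IsBrownianReal.memLp hB _)
      (IsBrownianReal.memLp hB _)]
    simp only [hB.toIsPreBrownianReal.covariance_eval]
    ring
  rw [h0, hv]

theorem StepFunction.measurable_integral_path (g : StepFunction) :
    Measurable (fun x : ℝ≥0 → ℝ => ∑ i, g.a i * (x (g.v i) - x (g.u i))) := by
  fun_prop

theorem hasLaw_sum_gaussianReal {ι : Type*} [Fintype ι] {S : ι → Ω → ℝ} {v : ι → ℝ≥0}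
    (hS : ∀ i, HasLaw (S i) (gaussianReal 0 (v i)) P) (hi : iIndepFun S P) :
    HasLaw (fun ω => ∑ i, S i ω) (gaussianReal 0 (∑ i, v i)) P := by
  have := hi.isProbabilityMeasure
  have hm : ∀ i, AEMeasurable (S i) P := fun i => (hS i).aemeasurable
  refine ⟨by fun_prop, Measure.ext_of_charFun ?_⟩
  rw [hi.charFun_map_fun_sum_eq_prod hm]
  ext t
  simp only [Finset.prod_apply, (hS _).map_eq, charFun_gaussianReal, ← Complex.exp_sum]
  congr 1
  push_cast
  simp [Finset.sum_div, Finset.sum_mul]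

theorem hasLaw_gaussianReal_of_tendsto [IsProbabilityMeasure P] {S : ℕ → Ω → ℝ} {Y : Ω → ℝ}
    {v : ℕ → ℝ≥0} {w : ℝ≥0} (hS : ∀ k, HasLaw (S k) (gaussianReal 0 (v k)) P)
    (hY : AEStronglyMeasurable Y P)
    (hSY : Tendsto (fun k => eLpNorm (S k - Y) 2 P) atTop (𝓝 0)) (hv : Tendsto v atTop (𝓝 w)) :
    HasLaw Y (gaussianReal 0 w) P := by
  have h1 := (tendstoInMeasure_of_tendsto_eLpNorm (by norm_num)
    (fun k => (hS k).aemeasurable.aestronglyMeasurable) hY hSY).tendstoInDistribution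
    (fun k => (hS k).aemeasurable)
  have h2 := ProbabilityMeasure.tendsto_iff_tendsto_charFun.1 h1.tendsto
  refine ⟨hY.aemeasurable, ?_⟩
  have := hY.aemeasurable
  refine Measure.ext_of_charFun (funext fun t => ?_)
  refine tendsto_nhds_unique (h2 t) ?_
  simp only [ProbabilityMeasure.coe_mk, (hS _).map_eq, charFun_gaussianReal]
  refine (Complex.continuous_exp.tendsto _).comp (tendsto_const_nhds.sub ?_)
  refine Tendsto.div_const (Tendsto.mul_const _ ?_) _
  exact (Complex.continuous_ofReal.tendsto _).comp ((NNReal.tendsto_coe).2 hv)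

theorem integral_sq_eq_toReal_eLpNorm {α : Type*} [MeasurableSpace α] {μ : Measure α} {f : α → ℝ}
    (hf : MemLp f 2 μ) : ∫ s, f s ^ 2 ∂μ = (eLpNorm f 2 μ).toReal ^ 2 := by
  rw [hf.eLpNorm_eq_integral_rpow_norm (by norm_num) (by norm_num), ENNReal.toReal_ofReal
    (by positivity)]
  simp only [ENNReal.toReal_ofNat, Real.rpow_ofNat, Real.norm_eq_abs, sq_abs]
  rw [← Real.rpow_mul_natCast (integral_nonneg fun _ => sq_nonneg _)]
  norm_num

theorem tendsto_integral_sq {α : Type*} [MeasurableSpace α] {μ : Measure α} {G : ℕ → α → ℝ}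
    {f : α → ℝ} (hG : ∀ k, MemLp (G k) 2 μ) (hf : MemLp f 2 μ)
    (h : Tendsto (fun k => eLpNorm (G k - f) 2 μ) atTop (𝓝 0)) :
    Tendsto (fun k => ∫ s, G k s ^ 2 ∂μ) atTop (𝓝 (∫ s, f s ^ 2 ∂μ)) := by
  simp only [integral_sq_eq_toReal_eLpNorm (hG _), integral_sq_eq_toReal_eLpNorm hf]
  refine Tendsto.pow ?_ 2
  have h' := (ENNReal.tendsto_toReal ENNReal.zero_ne_top).comp h
  rw [tendsto_iff_dist_tendsto_zero]
  refine squeeze_zero (fun _ => dist_nonneg) (fun k => ?_) h'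
  have e1 : (eLpNorm (G k) 2 μ).toReal = ‖(hG k).toLp‖ := (Lp.norm_toLp _ _).symm
  have e2 : (eLpNorm f 2 μ).toReal = ‖hf.toLp‖ := (Lp.norm_toLp _ _).symm
  have e3 : (eLpNorm (G k - f) 2 μ).toReal = ‖(hG k).toLp - hf.toLp‖ := by
    rw [← MemLp.toLp_sub]
    exact (Lp.norm_toLp _ _).symm
  rw [Function.comp_apply, e1, e2, e3]
  exact abs_norm_sub_norm_le _ _

/-- A sum of Wiener integrals against independent Brownian motions is Gaussian. -/
theorem IsWienerIntegral.hasLaw_sum [IsProbabilityMeasure P] {p : ℕ} {W : Fin p → ℝ≥0 → Ω → ℝ}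
    (hW : IsStandardBrownianMotion P W) {f : Fin p → ℝ → ℝ} {Y : Fin p → Ω → ℝ}
    (h : ∀ j, IsWienerIntegral P (W j) (f j) (Y j)) :
    HasLaw (fun ω => ∑ j, Y j ω) (gaussianReal 0 (∑ j, (∫ s, f j s ^ 2).toNNReal)) P := by
  choose hf hY g hg hgi using h
  have hlaw : ∀ k, HasLaw (fun ω => ∑ j, (g j k).integral (W j) ω)
      (gaussianReal 0 (∑ j, (∫ s, (g j k).toFun s ^ 2).toNNReal)) P := fun k =>
    hasLaw_sum_gaussianReal (fun j => (g j k).hasLaw_integral (hW.1 j))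
      (hW.2.comp (fun j x => ∑ i, (g j k).a i * (x ((g j k).v i) - x ((g j k).u i)))
        fun j => (g j k).measurable_integral_path)
  refine hasLaw_gaussianReal_of_tendsto hlaw (memLp_finsetSum _ fun j _ => hY j).1 ?_ ?_
  · have : ∀ k, ((fun ω => ∑ j, (g j k).integral (W j) ω) - fun ω => ∑ j, Y j ω) =
        ∑ j, fun ω => (g j k).integral (W j) ω - Y j ω := by
      intro k; ext ω; simp
    simp only [this]
    have hsum := tendsto_finsetSum Finset.univ fun j _ => hgi j
    rw [Finset.sum_const_zero] at hsum
    refine tendsto_of_tendsto_of_tendsto_of_le_of_le tendsto_const_nhds hsum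
      (fun k => zero_le) (fun k => ?_)
    exact eLpNorm_sum_le (fun j _ => (((g j k).memLp_integral (hW.1 j)).sub (hY j)).1)
      (by norm_num)
  · refine tendsto_finsetSum _ fun j _ => (continuous_real_toNNReal.tendsto _).comp ?_
    exact tendsto_integral_sq (fun k => (g j k).memLp) (hf j) (hg j)

/-- A family all of whose linear combinations are centered Gaussian with diagonal covariance
is distributed as a product of Gaussian laws. -/
theorem hasLaw_pi_gaussianReal_of_linear_combination [IsProbabilityMeasure P] {ι : Type*}
    [Fintype ι] {Y : ι → Ω → ℝ} {v : ι → ℝ≥0} (hY : ∀ i, AEMeasurable (Y i) P)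
    (h : ∀ c : ι → ℝ, HasLaw (fun ω => ∑ i, c i * Y i ω)
      (gaussianReal 0 (∑ i, (c i ^ 2).toNNReal * v i)) P) :
    HasLaw (fun ω i => Y i ω) (Measure.pi fun i => gaussianReal 0 (v i)) P := by
  refine ⟨by fun_prop, charFun_eq_pi_iff.1 fun t => ?_⟩
  have h1 := congrArg (fun μ => charFun μ 1) (h t.ofLp).map_eq
  beta_reduce at h1
  rw [charFun_gaussianReal, charFun_apply_real] at h1
  rw [integral_map (h t.ofLp).aemeasurable (by fun_prop)] at h1
  rw [charFun_apply, integral_map (by fun_prop) (by fun_prop), integral_map (by fun_prop)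
    (by fun_prop)]
  simp only [PiLp.inner_apply, charFun_gaussianReal, ← Complex.exp_sum]
  convert h1 using 4
  · simp
  · push_cast
    simp only [mul_zero, zero_mul, zero_sub, Finset.sum_neg_distrib, one_pow,
      mul_one, Real.coe_toNNReal _ (sq_nonneg _), Complex.ofReal_pow, mul_comm]
    rw [one_mul, Finset.sum_div]

end WienerLaw

/-! ### The joint law of the increments -/

theorem sq_sum_indicator_of_monotone {τ : ℕ → ℝ≥0} (hτ : Monotone τ) (γ : ℝ → ℝ) {n : ℕ}
    (c : Fin n → ℝ) (s : ℝ) :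
    (∑ l : Fin n, c l * (Set.Ioc (τ l : ℝ) (τ (l + 1) : ℝ)).indicator γ s) ^ 2 =
      ∑ l : Fin n, c l ^ 2 * (Set.Ioc (τ l : ℝ) (τ (l + 1) : ℝ)).indicator γ s ^ 2 := by
  rw [sq, Finset.sum_mul_sum]
  refine Finset.sum_congr rfl fun l _ => ?_
  rw [Finset.sum_eq_single l _ (by simp)]
  · ring
  · intro l' _ hl'
    by_cases h : s ∈ Set.Ioc (τ l : ℝ) (τ (l + 1) : ℝ)
    · by_cases h' : s ∈ Set.Ioc (τ l' : ℝ) (τ (l' + 1) : ℝ)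
      · exfalso
        rcases lt_or_gt_of_ne hl' with hlt | hlt
        · have h1 : (τ (l' + 1) : ℝ) ≤ τ l := NNReal.coe_le_coe.2 (hτ (by exact hlt))
          linarith [h.1, h'.2]
        · have h1 : (τ (l + 1) : ℝ) ≤ τ l' := NNReal.coe_le_coe.2 (hτ (by exact hlt))
          linarith [h.2, h'.1]
      · simp [Set.indicator_of_notMem h']
    · simp [Set.indicator_of_notMem h]

section Increments

variable {Ω : Type*} [MeasurableSpace Ω] {P : Measure Ω}

theorem SatisfiesScalarSDE.isWienerIntegral_increment [IsProbabilityMeasure P] {γ : ℝ → ℝ} {p : ℕ}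
    {W : Fin p → ℝ≥0 → Ω → ℝ} {X : ℝ≥0 → Ω → Fin p → ℝ} (hW : IsStandardBrownianMotion P W)
    (hX : SatisfiesScalarSDE P γ W X) (j : Fin p) {s t : ℝ≥0} (hst : s ≤ t) (ht : t ≤ 1) :
    IsWienerIntegral P (W j) ((Set.Ioc (s : ℝ) (t : ℝ)).indicator γ)
      (fun ω => X t ω j - X s ω j) := by
  convert (hX j t ht).add (hW.1 j) ((hX j s (hst.trans ht)).const_mul (-1)) using 1
  · ext r
    have h0 : (s : ℝ) ≤ t := hst
    by_cases h1 : r ∈ Set.Ioc (0 : ℝ) s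
    · have h2 : r ∈ Set.Ioc (0 : ℝ) t := ⟨h1.1, h1.2.trans h0⟩
      have h3 : r ∉ Set.Ioc (s : ℝ) t := fun h => absurd h1.2 (not_le.2 h.1)
      simp [Set.indicator_of_mem h1, Set.indicator_of_mem h2, Set.indicator_of_notMem h3]
    · by_cases h2 : r ∈ Set.Ioc (0 : ℝ) t
      · have h3 : r ∈ Set.Ioc (s : ℝ) t := ⟨not_le.1 fun h => h1 ⟨h2.1, h⟩, h2.2⟩
        simp [Set.indicator_of_notMem h1, Set.indicator_of_mem h2, Set.indicator_of_mem h3]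
      · have h3 : r ∉ Set.Ioc (s : ℝ) t := fun h => h2 ⟨s.2.trans_lt h.1, h.2⟩
        simp [Set.indicator_of_notMem h1, Set.indicator_of_notMem h2, Set.indicator_of_notMem h3]
  · ext ω
    ring

theorem SatisfiesScalarSDE.hasLaw_increments [IsProbabilityMeasure P] {γ : ℝ → ℝ} {p : ℕ}
    {W : Fin p → ℝ≥0 → Ω → ℝ} {X : ℝ≥0 → Ω → Fin p → ℝ} (hW : IsStandardBrownianMotion P W)
    (hX : SatisfiesScalarSDE P γ W X) {n : ℕ} {τ : ℕ → ℝ≥0} (hτ : Monotone τ) (hτn : τ n ≤ 1) :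
    HasLaw (fun ω (i : Fin n × Fin p) => X (τ (i.1 + 1)) ω i.2 - X (τ i.1) ω i.2)
      (Measure.pi fun i : Fin n × Fin p => gaussianReal 0
        (∫ s in Set.Ioc (τ i.1 : ℝ) (τ (i.1 + 1) : ℝ), γ s ^ 2).toNNReal) P := by
  have hinc : ∀ (j : Fin p) (l : Fin n), IsWienerIntegral P (W j)
      ((Set.Ioc (τ l : ℝ) (τ (l + 1) : ℝ)).indicator γ)
      (fun ω => X (τ (l + 1)) ω j - X (τ l) ω j) := fun j l =>
    hX.isWienerIntegral_increment hW j (hτ (Nat.le_succ _)) ((hτ l.2).trans hτn)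
  refine hasLaw_pi_gaussianReal_of_linear_combination
    (fun i => (hinc i.2 i.1).2.1.1.aemeasurable) fun c => ?_
  have key := IsWienerIntegral.hasLaw_sum hW fun j =>
    IsWienerIntegral.sum (hW.1 j) Finset.univ fun l => (hinc j l).const_mul (c (l, j))
  convert key using 2
  · rw [Fintype.sum_prod_type, Finset.sum_comm]
  · rw [Fintype.sum_prod_type, Finset.sum_comm]
    refine Finset.sum_congr rfl fun j _ => ?_
    simp only [sq_sum_indicator_of_monotone hτ]
    rw [integral_finsetSum _ fun l _ => ((hinc j l).1.integrable_sq).const_mul _,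
      Real.toNNReal_sum_of_nonneg]
    · refine Finset.sum_congr rfl fun l _ => ?_
      rw [integral_const_mul, Real.toNNReal_mul (sq_nonneg _)]
      congr 2
      rw [← integral_indicator measurableSet_Ioc]
      congr 1
      ext s
      by_cases h : s ∈ Set.Ioc (τ l : ℝ) (τ (l + 1) : ℝ) <;> simp [h]
    · exact fun l _ => integral_nonneg fun s => by positivity

/-- The law of a matrix with independent standard Gaussian entries. -/
noncomputable def gaussianMatrix (n p : ℕ) : Measure (Fin n → Fin p → ℝ) :=
  Measure.pi fun _ => Measure.pi fun _ => gaussianReal 0 1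

instance (n p : ℕ) : IsProbabilityMeasure (gaussianMatrix n p) := by
  unfold gaussianMatrix
  infer_instance

theorem hasLaw_gaussianMatrix {n p : ℕ} {Z : Fin n × Fin p → Ω → ℝ}
    (hZ : HasLaw (fun ω i => Z i ω) (Measure.pi fun _ => gaussianReal 0 1) P) :
    HasLaw (fun ω l j => Z (l, j) ω) (gaussianMatrix n p) P := by
  have hu : (gaussianMatrix n p).map (fun z (i : Fin n × Fin p) => z i.1 i.2) =
      Measure.pi fun _ => gaussianReal 0 1 := by
    have e1 : ∀ l : Fin n, HasLaw (fun z : Fin n → Fin p → ℝ => z l)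
        (Measure.pi fun _ => gaussianReal 0 1) (gaussianMatrix n p) := fun l =>
      (measurePreserving_eval (fun _ : Fin n => Measure.pi fun _ : Fin p => gaussianReal 0 1)
        l).hasLaw
    have e2 : ∀ (l : Fin n) (j : Fin p), HasLaw (fun z : Fin n → Fin p → ℝ => z l j)
        (gaussianReal 0 1) (gaussianMatrix n p) := fun l j =>
      (measurePreserving_eval (fun _ : Fin p => gaussianReal 0 1) j).hasLaw.comp (e1 l)
    have h1 : iIndepFun (fun (l : Fin n) (z : Fin n → Fin p → ℝ) => z l) (gaussianMatrix n p) :=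
      iIndepFun_pi (X := fun _ x => x) fun _ => aemeasurable_id
    have h2 : ∀ l : Fin n, iIndepFun (fun (j : Fin p) (z : Fin n → Fin p → ℝ) => z l j)
        (gaussianMatrix n p) := fun l => (iIndepFun_iff_hasLaw_pi_pi (e2 l)).2 (e1 l)
    have h := iIndepFun_uncurry' (X := fun l j (z : Fin n → Fin p → ℝ) => z l j) (by fun_prop) h1 h2
    exact (h.hasLaw_pi fun i : Fin n × Fin p => e2 i.1 i.2).map_eq
  have hc : Measurable (fun (x : Fin n × Fin p → ℝ) l j => x (l, j)) := by fun_prop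
  have : (gaussianMatrix n p) = (Measure.pi fun _ => gaussianReal 0 1).map
      (fun (x : Fin n × Fin p → ℝ) l j => x (l, j)) := by
    rw [← hu, Measure.map_map hc (by fun_prop)]
    exact (Measure.map_id).symm
  refine ⟨?_, ?_⟩
  · exact hc.comp_aemeasurable hZ.aemeasurable
  · rw [this, ← hZ.map_eq, AEMeasurable.map_map_of_aemeasurable hc.aemeasurable hZ.aemeasurable]
    rfl

theorem SatisfiesScalarSDE.hasLaw_normalized_increments [IsProbabilityMeasure P] {γ : ℝ → ℝ}
    {p : ℕ} {W : Fin p → ℝ≥0 → Ω → ℝ} {X : ℝ≥0 → Ω → Fin p → ℝ}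
    (hW : IsStandardBrownianMotion P W) (hX : SatisfiesScalarSDE P γ W X) {n : ℕ} {τ : ℕ → ℝ≥0}
    (hτ : Monotone τ) (hτn : τ n ≤ 1)
    (hw : ∀ l : Fin n, 0 < ∫ s in Set.Ioc (τ l : ℝ) (τ (l + 1) : ℝ), γ s ^ 2) :
    HasLaw (fun ω (l : Fin n) (j : Fin p) =>
      (√(∫ s in Set.Ioc (τ l : ℝ) (τ (l + 1) : ℝ), γ s ^ 2))⁻¹ *
        (X (τ (l + 1)) ω j - X (τ l) ω j)) (gaussianMatrix n p) P := by
  refine hasLaw_gaussianMatrix (Z := fun i ω =>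
    (√(∫ s in Set.Ioc (τ i.1 : ℝ) (τ (i.1 + 1) : ℝ), γ s ^ 2))⁻¹ *
        (X (τ (i.1 + 1)) ω i.2 - X (τ i.1) ω i.2)) ?_
  refine HasLaw.comp (Y := fun x i =>
    (√(∫ s in Set.Ioc (τ i.1 : ℝ) (τ (i.1 + 1) : ℝ), γ s ^ 2))⁻¹ * x i)
    ⟨(measurable_pi_lambda _ fun i => (measurable_pi_apply i).const_mul _).aemeasurable, ?_⟩
    (hX.hasLaw_increments hW hτ hτn)
  rw [Measure.pi_map_pi fun i => (measurable_id'.const_mul _).aemeasurable]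
  congr
  ext1 i
  rw [gaussianReal_map_const_mul, mul_zero]
  congr 1
  ext
  have := hw i.1
  simp only [NNReal.coe_mul, NNReal.coe_mk, inv_pow, Real.coe_toNNReal _ this.le, NNReal.coe_one,
    Real.sq_sqrt this.le]
  exact inv_mul_cancel₀ this.ne'

end Increments

/-! ### Tail bounds for Gaussian matrices -/

theorem integral_exp_mul_sq_gaussianReal {s : ℝ} (hs : s < 1 / 2) :
    ∫ x, Real.exp (s * x ^ 2) ∂gaussianReal 0 1 = (√(1 - 2 * s))⁻¹ := by
  rw [integral_gaussianReal_eq_integral_smul (by norm_num)]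
  have : ∀ x : ℝ, gaussianPDFReal 0 1 x • Real.exp (s * x ^ 2) =
      (√(2 * Real.pi))⁻¹ * Real.exp (-(1 / 2 - s) * x ^ 2) := by
    intro x
    simp only [gaussianPDFReal, NNReal.coe_one, mul_one, sub_zero, smul_eq_mul, mul_assoc,
      ← Real.exp_add]
    congr 2
    ring
  simp only [this]
  rw [integral_const_mul, integral_gaussian, ← Real.sqrt_inv, ← Real.sqrt_inv,
    ← Real.sqrt_mul (by positivity)]
  congr 1
  have : 1 / 2 - s ≠ 0 := by linarith
  have : 1 - 2 * s ≠ 0 := by linarith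
  field_simp

theorem integrable_exp_mul_sq_gaussianReal {s : ℝ} (hs : s < 1 / 2) :
    Integrable (fun x : ℝ => Real.exp (s * x ^ 2)) (gaussianReal 0 1) := by
  by_contra h
  have h1 := integral_exp_mul_sq_gaussianReal hs
  rw [integral_undef h] at h1
  have : 0 < (√(1 - 2 * s))⁻¹ := inv_pos.2 (Real.sqrt_pos.2 (by linarith))
  linarith

theorem mgf_sum_sq_gaussianReal (m : ℕ) {s : ℝ} (hs : s < 1 / 2) :
    Integrable (fun x : Fin m → ℝ => Real.exp (s * ∑ i, x i ^ 2))
      (Measure.pi fun _ => gaussianReal 0 1) ∧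
    mgf (fun x : Fin m → ℝ => ∑ i, x i ^ 2) (Measure.pi fun _ => gaussianReal 0 1) s =
      (√(1 - 2 * s))⁻¹ ^ m := by
  have : ∀ x : Fin m → ℝ, Real.exp (s * ∑ i, x i ^ 2) = ∏ i, Real.exp (s * x i ^ 2) := by
    intro x
    rw [Finset.mul_sum, Real.exp_sum]
  simp only [mgf, this]
  refine ⟨Integrable.fintype_prod (f := fun _ x => Real.exp (s * x ^ 2))
    fun _ => integrable_exp_mul_sq_gaussianReal hs, ?_⟩
  rw [integral_fintype_prod_eq_prod (fun _ x => Real.exp (s * x ^ 2))]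
  simp [integral_exp_mul_sq_gaussianReal hs]

theorem inv_sqrt_one_sub_le_exp {s : ℝ} (hs : s ≤ 1 / 4) :
    (√(1 - 2 * s))⁻¹ ≤ Real.exp (s + 4 * s ^ 2) := by
  have h0 : 0 < 1 - 2 * s := by linarith
  have h1 : Real.exp (-(s + 4 * s ^ 2)) ≤ √(1 - 2 * s) := by
    refine Real.le_sqrt_of_sq_le ?_
    rw [← Real.exp_nat_mul, ← Real.le_log_iff_exp_le h0]
    refine le_trans ?_ (Real.one_sub_inv_le_log_of_pos h0)
    rw [← sub_nonneg]
    have : 1 - (1 - 2 * s)⁻¹ - (2 : ℕ) * -(s + 4 * s ^ 2) =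
        4 * s ^ 2 * (1 - 4 * s) / (1 - 2 * s) := by
      push_cast
      field_simp
      ring
    rw [this]
    have : 0 ≤ 1 - 4 * s := by linarith
    positivity
  rw [inv_le_comm₀ (Real.sqrt_pos.2 h0) (Real.exp_pos _), ← Real.exp_neg]
  exact h1

theorem measureReal_sum_sq_ge_le (p : ℕ) {δ : ℝ} (h0 : 0 ≤ δ) (h1 : δ ≤ 1) :
    (Measure.pi fun _ => gaussianReal 0 1).real {x : Fin p → ℝ | (1 + δ) * p ≤ ∑ i, x i ^ 2} ≤
      Real.exp (-(δ ^ 2 / 16) * p) := by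
  have hm := mgf_sum_sq_gaussianReal p (s := δ / 8) (by linarith)
  refine (measure_ge_le_exp_mul_mgf _ (by positivity) hm.1).trans ?_
  rw [hm.2]
  calc _ ≤ Real.exp (-(δ / 8) * ((1 + δ) * p)) * Real.exp (δ / 8 + 4 * (δ / 8) ^ 2) ^ p := by
        gcongr
        exact inv_sqrt_one_sub_le_exp (by linarith)
    _ = _ := by
        rw [← Real.exp_nat_mul, ← Real.exp_add]
        congr 1
        ring

theorem measureReal_sum_sq_le_le (p : ℕ) {δ : ℝ} (h0 : 0 ≤ δ) :
    (Measure.pi fun _ => gaussianReal 0 1).real {x : Fin p → ℝ | ∑ i, x i ^ 2 ≤ (1 - δ) * p} ≤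
      Real.exp (-(δ ^ 2 / 16) * p) := by
  have hm := mgf_sum_sq_gaussianReal p (s := -(δ / 8)) (by linarith)
  refine (measure_le_le_exp_mul_mgf _ (by linarith) hm.1).trans ?_
  rw [hm.2]
  calc _ ≤ Real.exp (- -(δ / 8) * ((1 - δ) * p)) * Real.exp (-(δ / 8) + 4 * (-(δ / 8)) ^ 2) ^ p := by
        gcongr
        exact inv_sqrt_one_sub_le_exp (by linarith)
    _ = _ := by
        rw [← Real.exp_nat_mul, ← Real.exp_add]
        congr 1
        ring

theorem measureReal_four_mul_le_sum_sq_le (m : ℕ) :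
    (Measure.pi fun _ => gaussianReal 0 1).real
      {x : Fin m → ℝ | 4 * ((m : ℝ) + 1) ≤ ∑ i, x i ^ 2} ≤ Real.exp (-((m : ℝ) + 1) / 2) := by
  have hm := mgf_sum_sq_gaussianReal m (s := 1 / 4) (by norm_num)
  refine (measure_ge_le_exp_mul_mgf _ (by positivity) hm.1).trans ?_
  rw [hm.2]
  have h2 : (√(1 - 2 * (1 / 4)))⁻¹ ≤ Real.exp (1 / 2) := by
    rw [← Real.sqrt_inv, Real.sqrt_le_iff]
    refine ⟨by positivity, ?_⟩
    rw [← Real.exp_nat_mul]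
    norm_num
    linarith [Real.add_one_le_exp 1]
  calc _ ≤ Real.exp (-(1 / 4) * (4 * ((m : ℝ) + 1))) * Real.exp (1 / 2) ^ m := by gcongr
    _ ≤ _ := by
        rw [← Real.exp_nat_mul, ← Real.exp_add]
        gcongr
        linarith

theorem gaussianMatrix_row {n p : ℕ} (l : Fin n) {s : Set (Fin p → ℝ)} (hs : MeasurableSet s) :
    gaussianMatrix n p {z | z l ∈ s} = (Measure.pi fun _ => gaussianReal 0 1) s :=
  (measurePreserving_eval (fun _ : Fin n => Measure.pi fun _ : Fin p => gaussianReal 0 1)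
    l).measure_preimage hs.nullMeasurableSet

theorem gaussianMatrix_sum_sq_not_mem_Icc_le {n p : ℕ} (l : Fin n) {δ : ℝ} (h0 : 0 ≤ δ)
    (h1 : δ ≤ 1) :
    gaussianMatrix n p {z | ∑ j, z l j ^ 2 ∉ Set.Icc ((1 - δ) * p) ((1 + δ) * p)} ≤
      ENNReal.ofReal (2 * Real.exp (-(δ ^ 2 / 16) * p)) := by
  have hm : Measurable (fun x : Fin p → ℝ => ∑ j, x j ^ 2) := by fun_prop
  refine (measure_mono (t := {z | z l ∈ {x : Fin p → ℝ | ∑ j, x j ^ 2 ≤ (1 - δ) * p}} ∪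
    {z | z l ∈ {x : Fin p → ℝ | (1 + δ) * p ≤ ∑ j, x j ^ 2}}) ?_).trans
    ((measure_union_le _ _).trans ?_)
  · intro z hz
    simp only [Set.mem_ofPred_eq, Set.mem_Icc, not_and_or, not_le] at hz
    exact hz.imp le_of_lt le_of_lt
  · rw [gaussianMatrix_row l (measurableSet_le hm measurable_const),
      gaussianMatrix_row l (measurableSet_le measurable_const hm), two_mul,
      ENNReal.ofReal_add (by positivity) (by positivity)]
    gcongr
    · rw [← ofReal_measureReal]
      exact ENNReal.ofReal_le_ofReal (measureReal_sum_sq_le_le p h0)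
    · rw [← ofReal_measureReal]
      exact ENNReal.ofReal_le_ofReal (measureReal_sum_sq_ge_le p h0 h1)

theorem hasLaw_linear_form {p : ℕ} (a : Fin p → ℝ) :
    HasLaw (fun x : Fin p → ℝ => ∑ j, a j * x j) (gaussianReal 0 (∑ j, a j ^ 2).toNNReal)
      (Measure.pi fun _ => gaussianReal 0 1) := by
  have h : ∀ j : Fin p, HasLaw (fun x : Fin p → ℝ => a j * x j)
      (gaussianReal 0 (⟨a j ^ 2, sq_nonneg _⟩ * 1)) (Measure.pi fun _ => gaussianReal 0 1) := by
    intro j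
    have := gaussianReal_const_mul
      (measurePreserving_eval (fun _ : Fin p => gaussianReal 0 1) j).hasLaw (a j)
    rwa [mul_zero] at this
  have hi : iIndepFun (fun (j : Fin p) (x : Fin p → ℝ) => a j * x j)
      (Measure.pi fun _ => gaussianReal 0 1) :=
    iIndepFun_pi (X := fun j x => a j * x) fun j => by fun_prop
  convert hasLaw_sum_gaussianReal h hi using 2
  ext
  rw [Real.coe_toNNReal _ (Finset.sum_nonneg fun _ _ => sq_nonneg _), NNReal.coe_sum]
  exact Finset.sum_congr rfl fun j _ => (mul_one (a j ^ 2)).symm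

theorem map_linear_form_gaussianMatrix {m p : ℕ} {a : Fin p → ℝ} (ha : 0 < ∑ j, a j ^ 2) :
    (gaussianMatrix m p).map (fun v l => (√(∑ j, a j ^ 2))⁻¹ * ∑ j, a j * v l j) =
      Measure.pi fun _ => gaussianReal 0 1 := by
  have h := gaussianReal_const_mul (hasLaw_linear_form a) (√(∑ j, a j ^ 2))⁻¹
  unfold gaussianMatrix
  have hm : Measurable fun x : Fin p → ℝ => (√(∑ j, a j ^ 2))⁻¹ * ∑ j, a j * x j := by fun_prop
  rw [Measure.pi_map_pi (f := fun (l : Fin m) (x : Fin p → ℝ) =>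
    (√(∑ j, a j ^ 2))⁻¹ * ∑ j, a j * x j) fun _ => hm.aemeasurable]
  congr
  ext1 l
  rw [h.map_eq, mul_zero]
  congr 1
  ext
  simp only [NNReal.coe_mul, NNReal.coe_mk, inv_pow, Real.coe_toNNReal _ ha.le, NNReal.coe_one,
    Real.sq_sqrt ha.le]
  exact inv_mul_cancel₀ ha.ne'

theorem gaussianMatrix_linear_form_le (m : ℕ) {p : ℕ} (a : Fin p → ℝ) :
    gaussianMatrix m p
      {v | 4 * ((m : ℝ) + 1) * ∑ j, a j ^ 2 < ∑ l, (∑ j, a j * v l j) ^ 2} ≤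
      ENNReal.ofReal (Real.exp (-((m : ℝ) + 1) / 2)) := by
  rcases (Finset.sum_nonneg fun j _ => sq_nonneg (a j) :
    0 ≤ ∑ j, a j ^ 2).eq_or_lt with h0 | h0
  · have ha : ∀ j, a j = 0 := fun j => by
      have := (Finset.sum_eq_zero_iff_of_nonneg fun j _ => sq_nonneg (a j)).1 h0.symm j
        (Finset.mem_univ _)
      simpa using this
    simp [ha]
  · refine le_trans ?_ (ENNReal.ofReal_le_ofReal (measureReal_four_mul_le_sum_sq_le m))
    rw [ofReal_measureReal, ← map_linear_form_gaussianMatrix (m := m) h0,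
      Measure.map_apply (by fun_prop) (measurableSet_le (by fun_prop) (by fun_prop))]
    refine measure_mono fun v hv => ?_
    simp only [Set.mem_ofPred_eq, Set.mem_preimage, mul_pow, ← Finset.mul_sum, inv_pow,
      Real.sq_sqrt h0.le] at hv ⊢
    rw [inv_mul_eq_div, le_div_iff₀ h0]
    exact hv.le

theorem gaussianMatrix_sum_sq_inner_le {n p : ℕ} (k : Fin n) :
    gaussianMatrix n p {z | 4 * (n : ℝ) * ∑ j, z k j ^ 2 <
      ∑ l ∈ Finset.univ.erase k, (∑ j, z k j * z l j) ^ 2} ≤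
      ENNReal.ofReal (Real.exp (-(n : ℝ) / 2)) := by
  obtain ⟨m, rfl⟩ : ∃ m, n = m + 1 := ⟨n - 1, by have := k.2; omega⟩
  have hmp := measurePreserving_piFinSuccAbove
    (fun _ : Fin (m + 1) => Measure.pi fun _ : Fin p => gaussianReal 0 1) k
  set S : Set ((Fin p → ℝ) × (Fin m → Fin p → ℝ)) :=
    {q | 4 * ((m : ℝ) + 1) * ∑ j, q.1 j ^ 2 < ∑ l, (∑ j, q.1 j * q.2 l j) ^ 2} with hS
  have hSm : MeasurableSet S := measurableSet_lt (by fun_prop) (by fun_prop)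
  have he : {z : Fin (m + 1) → Fin p → ℝ | 4 * ((m + 1 : ℕ) : ℝ) * ∑ j, z k j ^ 2 <
      ∑ l ∈ Finset.univ.erase k, (∑ j, z k j * z l j) ^ 2} =
      (MeasurableEquiv.piFinSuccAbove (fun _ => Fin p → ℝ) k) ⁻¹' S := by
    ext z
    have : ∑ l ∈ Finset.univ.erase k, (∑ j, z k j * z l j) ^ 2 =
        ∑ l : Fin m, (∑ j, z k j * z (k.succAbove l) j) ^ 2 := by
      rw [Finset.sum_erase_eq_sub (Finset.mem_univ k), Fin.sum_univ_succAbove _ k]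
      ring
    rw [Set.mem_ofPred_eq, this]
    simp [hS, Fin.removeNth]
  rw [he, show gaussianMatrix (m + 1) p = Measure.pi fun _ => Measure.pi fun _ => gaussianReal 0 1
    from rfl, hmp.measure_preimage hSm.nullMeasurableSet, Measure.prod_apply hSm]
  calc _ ≤ ∫⁻ _ : Fin p → ℝ, ENNReal.ofReal (Real.exp (-((m : ℝ) + 1) / 2))
        ∂(Measure.pi fun _ => gaussianReal 0 1) :=
        lintegral_mono fun a => gaussianMatrix_linear_form_le m a
    _ = _ := by simp

/-- The rows of a Gaussian matrix have nearly equal lengths and are nearly orthogonal, up to an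
exponentially small probability. -/
theorem gaussianMatrix_exceptional_le {n p : ℕ} {δ : ℝ} (h0 : 0 ≤ δ) (h1 : δ ≤ 1) :
    gaussianMatrix n p {z | ∃ k, ∑ j, z k j ^ 2 ∉ Set.Icc ((1 - δ) * p) ((1 + δ) * p) ∨
      4 * (n : ℝ) * ∑ j, z k j ^ 2 < ∑ l ∈ Finset.univ.erase k, (∑ j, z k j * z l j) ^ 2} ≤
      ENNReal.ofReal (n * (2 * Real.exp (-(δ ^ 2 / 16) * p) + Real.exp (-(n : ℝ) / 2))) := by
  rw [Set.ofPred_exists]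
  refine (measure_iUnion_fintype_le _ _).trans ?_
  calc _ ≤ ∑ _ : Fin n, ENNReal.ofReal (2 * Real.exp (-(δ ^ 2 / 16) * p) +
        Real.exp (-(n : ℝ) / 2)) := by
        refine Finset.sum_le_sum fun k _ => ?_
        rw [Set.ofPred_or, ENNReal.ofReal_add (by positivity) (by positivity)]
        exact (measure_union_le _ _).trans (add_le_add
          (gaussianMatrix_sum_sq_not_mem_Icc_le k h0 h1) (gaussianMatrix_sum_sq_inner_le k))
    _ = _ := by
        rw [Finset.sum_const, Finset.card_univ, Fintype.card_fin, nsmul_eq_mul,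
          ENNReal.ofReal_mul (by positivity), ENNReal.ofReal_natCast]

/-! ### Counting large eigenvalues of a Gram matrix -/

section Gram

variable {ι κ : Type*} [Fintype ι] [DecidableEq κ] {a : ι → κ → ℝ} {lam : κ → ℝ}

theorem sum_sum_mul_filtered_gram (h : ∀ i j, ∑ k, a k i * a k j = if i = j then lam i else 0)
    {I J : Finset κ} (hIJ : J ⊆ I) :
    ∑ k, ∑ l, (∑ i ∈ I, a k i * a l i) * (∑ j ∈ J, a k j * a l j) = ∑ j ∈ J, lam j ^ 2 := by
  have e : ∀ k l, (∑ i ∈ I, a k i * a l i) * (∑ j ∈ J, a k j * a l j) =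
      ∑ i ∈ I, ∑ j ∈ J, (a k i * a k j) * (a l i * a l j) := by
    intro k l
    rw [Finset.sum_mul_sum]
    exact Finset.sum_congr rfl fun i _ => Finset.sum_congr rfl fun j _ => by ring
  have e' : ∀ i ∈ I, ∀ j ∈ J, ∑ k, ∑ l, (a k i * a k j) * (a l i * a l j) =
      if i = j then lam i ^ 2 else 0 := by
    intro i _ j _
    rw [← Finset.sum_mul_sum, h]
    split_ifs <;> ring
  simp only [e]
  calc _ = ∑ k, ∑ i ∈ I, ∑ j ∈ J, ∑ l, (a k i * a k j) * (a l i * a l j) := by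
        refine Finset.sum_congr rfl fun k _ => ?_
        rw [Finset.sum_comm]
        exact Finset.sum_congr rfl fun i _ => Finset.sum_comm
    _ = ∑ i ∈ I, ∑ j ∈ J, ∑ k, ∑ l, (a k i * a k j) * (a l i * a l j) := by
        rw [Finset.sum_comm]
        exact Finset.sum_congr rfl fun i _ => Finset.sum_comm
    _ = ∑ i ∈ I, ∑ j ∈ J, if i = j then lam i ^ 2 else 0 :=
        Finset.sum_congr rfl fun i hi => Finset.sum_congr rfl fun j hj => e' i hi j hj
    _ = _ := by
        rw [Finset.sum_comm]
        exact Finset.sum_congr rfl fun j hj => by rw [Finset.sum_ite_eq', if_pos (hIJ hj)]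

theorem sum_filtered_gram_diag (h : ∀ i j, ∑ k, a k i * a k j = if i = j then lam i else 0)
    (J : Finset κ) : ∑ k, ∑ j ∈ J, a k j * a k j = ∑ j ∈ J, lam j := by
  rw [Finset.sum_comm]
  exact Finset.sum_congr rfl fun j _ => by rw [h, if_pos rfl]

theorem le_sum_sq_filter [Fintype κ]
    (h : ∀ i j, ∑ k, a k i * a k j = if i = j then lam i else 0) {B : ℝ}
    (hB : 0 ≤ B) :
    ∑ k, (∑ i, a k i * a k i) ^ 2 - B * ∑ k, ∑ i, a k i * a k i ≤
      ∑ j with B < lam j, lam j ^ 2 := by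
  have hlam : ∀ i, 0 ≤ lam i := fun i => by
    have := h i i
    rw [if_pos rfl] at this
    rw [← this]
    exact Finset.sum_nonneg fun _ _ => mul_self_nonneg _
  have h1 : ∑ k, (∑ i, a k i * a k i) ^ 2 ≤ ∑ i, lam i ^ 2 := by
    rw [← sum_sum_mul_filtered_gram h (Finset.Subset.refl Finset.univ)]
    refine Finset.sum_le_sum fun k _ => ?_
    rw [sq]
    exact Finset.single_le_sum (f := fun l => (∑ i, a k i * a l i) * (∑ i, a k i * a l i))
      (fun l _ => mul_self_nonneg _) (Finset.mem_univ k)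
  rw [sum_filtered_gram_diag h, Finset.mul_sum]
  have h2 : ∑ i, lam i ^ 2 - ∑ i, B * lam i ≤ ∑ j with B < lam j, lam j ^ 2 := by
    rw [Finset.sum_filter, ← Finset.sum_sub_distrib]
    refine Finset.sum_le_sum fun i _ => ?_
    have := hlam i
    split_ifs with hi
    · nlinarith
    · nlinarith
  linarith

variable [DecidableEq ι]

theorem sum_sq_offdiag_le (f : ι → ι → ℝ) :
    ∑ k, ∑ l ∈ Finset.univ.erase k, f k l ^ 2 ≤ ∑ k, ∑ l, f k l ^ 2 :=
  Finset.sum_le_sum fun _ _ =>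
    Finset.sum_le_sum_of_subset_of_nonneg (Finset.subset_univ _) fun _ _ _ => sq_nonneg _

variable [Fintype κ]

/-- If the rows of `a` have squared lengths at most `D` and small mutual inner products, then
the eigenvalues in `J` satisfy `√(∑ λ_j²) ≤ D √|J| + √E` with `E` the off-diagonal energy. -/
theorem sqrt_sum_sq_le (h : ∀ i j, ∑ k, a k i * a k j = if i = j then lam i else 0)
    {D E : ℝ} (hD0 : 0 ≤ D) (hD : ∀ k, ∑ i, a k i * a k i ≤ D)
    (hE : ∑ k, ∑ l ∈ Finset.univ.erase k, (∑ i, a k i * a l i) ^ 2 ≤ E) (J : Finset κ) :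
    √(∑ j ∈ J, lam j ^ 2) ≤ D * √(J.card : ℝ) + √E := by
  set q := √(∑ j ∈ J, lam j ^ 2) with hq
  have hQ : 0 ≤ ∑ j ∈ J, lam j ^ 2 := Finset.sum_nonneg fun _ _ => sq_nonneg _
  have hq2 : q ^ 2 = ∑ j ∈ J, lam j ^ 2 := Real.sq_sqrt hQ
  have hq0 : 0 ≤ q := Real.sqrt_nonneg _
  have hsplit : q ^ 2 = ∑ k, (∑ i, a k i * a k i) * (∑ j ∈ J, a k j * a k j) +
      ∑ k, ∑ l ∈ Finset.univ.erase k, (∑ i, a k i * a l i) * (∑ j ∈ J, a k j * a l j) := by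
    rw [hq2, ← sum_sum_mul_filtered_gram h (Finset.subset_univ J), ← Finset.sum_add_distrib]
    exact Finset.sum_congr rfl fun k _ => (Finset.add_sum_erase _ _ (Finset.mem_univ k)).symm
  have hdiag : ∑ k, (∑ i, a k i * a k i) * (∑ j ∈ J, a k j * a k j) ≤ D * (√(J.card : ℝ) * q) := by
    calc _ ≤ ∑ k, D * (∑ j ∈ J, a k j * a k j) := Finset.sum_le_sum fun k _ =>
          mul_le_mul_of_nonneg_right (hD k) (Finset.sum_nonneg fun _ _ => mul_self_nonneg _)
      _ = D * ∑ j ∈ J, lam j := by rw [← Finset.mul_sum, sum_filtered_gram_diag h]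
      _ ≤ D * (√(J.card : ℝ) * q) := by
          gcongr
          rw [hq, ← Real.sqrt_mul (by positivity)]
          exact Real.le_sqrt_of_sq_le sq_sum_le_card_mul_sum_sq
  have hoff : ∑ k, ∑ l ∈ Finset.univ.erase k,
      (∑ i, a k i * a l i) * (∑ j ∈ J, a k j * a l j) ≤ √E * q := by
    have h1 := Real.sum_mul_le_sqrt_mul_sqrt
      (Finset.univ.sigma fun k : ι => Finset.univ.erase k)
      (fun x => ∑ i, a x.1 i * a x.2 i) (fun x => ∑ j ∈ J, a x.1 j * a x.2 j)
    simp only [Finset.sum_sigma] at h1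
    refine h1.trans (mul_le_mul (Real.sqrt_le_sqrt hE) (Real.sqrt_le_sqrt ?_)
      (Real.sqrt_nonneg _) (Real.sqrt_nonneg _))
    refine (sum_sq_offdiag_le fun k l => ∑ j ∈ J, a k j * a l j).trans ?_
    simp only [sq (∑ j ∈ J, _)]
    exact (sum_sum_mul_filtered_gram h (Finset.Subset.refl J)).le
  by_contra! hlt
  have hpos : 0 < q := lt_of_le_of_lt (by positivity) hlt
  nlinarith [mul_lt_mul_of_pos_right hlt hpos]

/-- A lower bound for the number of eigenvalues exceeding `B`. -/
theorem le_card_filter_lt (h : ∀ i j, ∑ k, a k i * a k j = if i = j then lam i else 0)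
    {B D T : ℝ} (hB : 0 ≤ B) (hD0 : 0 ≤ D) (hT0 : 0 ≤ T) (hD : ∀ k, ∑ i, a k i * a k i ≤ D)
    (hE : 4 * ∑ k, ∑ l ∈ Finset.univ.erase k, (∑ i, a k i * a l i) ^ 2 ≤ T)
    (hT : T ≤ ∑ k, (∑ i, a k i * a k i) ^ 2 - B * ∑ k, ∑ i, a k i * a k i) :
    T ≤ 4 * D ^ 2 * (Finset.univ.filter fun j => B < lam j).card := by
  have h1 := sqrt_sum_sq_le h hD0 hD (E := T / 4) (by linarith)
    (Finset.univ.filter fun j => B < lam j)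
  have h2 := Real.sqrt_le_sqrt (hT.trans (le_sum_sq_filter h hB))
  have h3 : √(T / 4) = √T / 2 := by
    rw [Real.sqrt_div hT0]
    congr 1
    rw [show (4 : ℝ) = 2 ^ 2 by norm_num, Real.sqrt_sq (by norm_num)]
  have h4 : √T ≤ 2 * (D * √((Finset.univ.filter fun j => B < lam j).card : ℝ)) := by linarith
  calc T = √T ^ 2 := (Real.sq_sqrt hT0).symm
    _ ≤ (2 * (D * √((Finset.univ.filter fun j => B < lam j).card : ℝ))) ^ 2 := by gcongr
    _ = _ := by
        rw [mul_pow, mul_pow, Real.sq_sqrt (by positivity)]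
        ring

end Gram

/-- The eigenvectors of `∑ x_l x_lᵀ` diagonalize the associated quadratic form, and the inner
products of the `x_l` can be computed in the eigenbasis. -/
theorem exists_gram_factor {n p : ℕ} (x : Fin n → Fin p → ℝ) {A : Matrix (Fin p) (Fin p) ℝ}
    (hA : A.IsHermitian) (hx : A = ∑ l, Matrix.vecMulVec (x l) (x l)) :
    ∃ a : Fin n → Fin p → ℝ,
      (∀ i j, ∑ k, a k i * a k j = if i = j then hA.eigenvalues i else 0) ∧
      ∀ k l, ∑ i, a k i * a l i = ∑ j, x k j * x l j := by
  refine ⟨fun l i => inner ℝ (WithLp.toLp 2 (x l)) (hA.eigenvectorBasis i), ?_, ?_⟩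
  · intro i j
    have hin : ∀ (l : Fin n) (i : Fin p), inner ℝ (WithLp.toLp 2 (x l)) (hA.eigenvectorBasis i) =
        ⇑(hA.eigenvectorBasis i) ⬝ᵥ x l := by
      intro l i
      simp [EuclideanSpace.inner_eq_star_dotProduct]
    have h1 : ∀ v w : Fin p → ℝ, v ⬝ᵥ A.mulVec w = ∑ k, (v ⬝ᵥ x k) * (w ⬝ᵥ x k) := by
      intro v w
      rw [hx, Matrix.sum_mulVec, dotProduct_sum]
      refine Finset.sum_congr rfl fun k _ => ?_
      rw [Matrix.vecMulVec_mulVec, dotProduct_comm (x k)]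
      simp [dotProduct_smul, mul_comm]
    simp only [hin]
    rw [← h1, hA.mulVec_eigenvectorBasis, dotProduct_smul]
    have h2 := orthonormal_iff_ite.1 hA.eigenvectorBasis.orthonormal j i
    rw [EuclideanSpace.inner_eq_star_dotProduct] at h2
    simp only [star_trivial] at h2
    rw [h2]
    by_cases hij : i = j
    · subst hij; simp
    · simp [hij, Ne.symm hij]
  · intro k l
    have := hA.eigenvectorBasis.sum_inner_mul_inner (WithLp.toLp 2 (x k)) (WithLp.toLp 2 (x l))
    simp only [real_inner_comm] at this ⊢
    rw [this]
    simp [EuclideanSpace.inner_eq_star_dotProduct, dotProduct, mul_comm]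

/-! ### The spot volatility -/

theorem CadlagOnUnitInterval.exists_eventually_abs_le {γ : ℝ → ℝ} (hγ : CadlagOnUnitInterval γ)
    {x : ℝ} (hx : x ∈ Set.Icc (0 : ℝ) 1) :
    ∃ K, ∀ᶠ s in 𝓝 x, s ∈ Set.Icc (0 : ℝ) 1 → |γ s| ≤ K := by
  have hleft : ∃ K, ∀ᶠ s in 𝓝[<] x, s ∈ Set.Icc (0 : ℝ) 1 → |γ s| ≤ K := by
    rcases hx.1.eq_or_lt with h0 | h0
    · exact ⟨0, eventually_mem_nhdsWithin.mono fun s hs hs' =>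
        absurd hs'.1 (not_le.2 (h0 ▸ hs))⟩
    · obtain ⟨l, hl⟩ := hγ.2 x ⟨h0, hx.2⟩
      exact ⟨|l| + 1, (hl.abs.eventually (gt_mem_nhds (lt_add_one _))).mono fun s hs _ => hs.le⟩
  have hright : ∃ K, ∀ᶠ s in 𝓝[≥] x, s ∈ Set.Icc (0 : ℝ) 1 → |γ s| ≤ K := by
    rcases hx.2.eq_or_lt with h1 | h1
    · refine ⟨|γ x|, eventually_mem_nhdsWithin.mono fun s hs hs' => ?_⟩
      rw [le_antisymm (hs'.2.trans h1.ge) hs]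
    · have hl : Tendsto γ (𝓝[≥] x) (𝓝 (γ x)) := hγ.1 x ⟨hx.1, h1⟩
      exact ⟨|γ x| + 1, (hl.abs.eventually (gt_mem_nhds (lt_add_one _))).mono fun s hs _ => hs.le⟩
  obtain ⟨K, hK⟩ := hleft
  obtain ⟨K', hK'⟩ := hright
  refine ⟨max K K', ?_⟩
  rw [← nhdsLT_sup_nhdsGE, eventually_sup]
  exact ⟨hK.mono fun s hs h => (hs h).trans (le_max_left _ _),
    hK'.mono fun s hs h => (hs h).trans (le_max_right _ _)⟩

theorem CadlagOnUnitInterval.exists_sq_le {γ : ℝ → ℝ} (hγ : CadlagOnUnitInterval γ) :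
    ∃ K, 0 < K ∧ ∀ t ∈ Set.Icc (0 : ℝ) 1, γ t ^ 2 ≤ K := by
  obtain ⟨K, hK⟩ : ∃ K, ∀ t ∈ Set.Icc (0 : ℝ) 1, |γ t| ≤ K := by
    refine isCompact_Icc.induction_on (s := Set.Icc (0 : ℝ) 1)
      (p := fun s => ∃ K, ∀ t ∈ s, |γ t| ≤ K) ⟨0, by simp⟩ ?_ ?_ ?_
    · rintro s t hst ⟨K, hK⟩
      exact ⟨K, fun r hr => hK r (hst hr)⟩
    · rintro s t ⟨K, hK⟩ ⟨K', hK'⟩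
      refine ⟨max K K', fun r hr => hr.elim (fun h => ?_) fun h => ?_⟩
      · exact (hK r h).trans (le_max_left _ _)
      · exact (hK' r h).trans (le_max_right _ _)
    · intro x hx
      obtain ⟨K, hK⟩ := hγ.exists_eventually_abs_le hx
      exact ⟨_, inter_mem_nhdsWithin _ hK, K, fun t ht => ht.2 ht.1⟩
  refine ⟨K ^ 2 + 1, by positivity, fun t ht => ?_⟩
  have := sq_le_sq' (by linarith [abs_nonneg (γ t), hK t ht]) (hK t ht)
  rw [sq_abs] at this
  linarith

theorem CadlagOnUnitInterval.exists_interval_sq_far {γ : ℝ → ℝ} (hγ : CadlagOnUnitInterval γ)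
    (hγ_pos : ∀ t ∈ Set.Icc (0 : ℝ) 1, 0 < γ t)
    (hγ_nonconst : ¬ ∃ c : ℝ, ∀ t ∈ Set.Ico (0 : ℝ) 1, γ t = c) (S : ℝ) :
    ∃ t₀ h η c : ℝ, 0 ≤ t₀ ∧ 0 < h ∧ t₀ + h ≤ 1 ∧ 0 < η ∧ 2 * η ≤ |c - S| ∧
      ∀ t ∈ Set.Icc t₀ (t₀ + h), |γ t ^ 2 - c| ≤ η := by
  obtain ⟨t₀, ht₀, hne⟩ : ∃ t ∈ Set.Ico (0 : ℝ) 1, γ t ^ 2 ≠ S := by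
    by_contra! hcon
    refine hγ_nonconst ⟨√S, fun t ht => ?_⟩
    rw [← hcon t ht, Real.sqrt_sq (hγ_pos t ⟨ht.1, ht.2.le⟩).le]
  have hη : 0 < |γ t₀ ^ 2 - S| / 2 := half_pos (abs_pos.2 (sub_ne_zero.2 hne))
  have hlim : Tendsto (fun t => γ t ^ 2) (𝓝[≥] t₀) (𝓝 (γ t₀ ^ 2)) := (hγ.1 t₀ ht₀).pow 2
  have hev : {t | |γ t ^ 2 - γ t₀ ^ 2| < |γ t₀ ^ 2 - S| / 2} ∈ 𝓝[≥] t₀ := by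
    filter_upwards [hlim.eventually (Metric.ball_mem_nhds _ hη)] with t ht
    exact ht
  obtain ⟨u, hu, hsub⟩ := mem_nhdsGE_iff_exists_Icc_subset.1 hev
  have hu0 : t₀ < u := hu
  refine ⟨t₀, min u 1 - t₀, |γ t₀ ^ 2 - S| / 2, γ t₀ ^ 2, ht₀.1, ?_, ?_, hη, by linarith, ?_⟩
  · linarith [lt_min hu0 ht₀.2]
  · linarith [min_le_right u 1]
  · intro t ht
    exact (hsub ⟨ht.1, by linarith [ht.2, min_le_left u 1]⟩ : _ < _).le

/-- The integrated variance over the `l`-th cell of the regular grid with `n` cells. -/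
noncomputable def cellVariance (γ : ℝ → ℝ) (n l : ℕ) : ℝ :=
  ∫ s in ((l : ℝ) / n)..(((l + 1 : ℕ) : ℝ) / n), γ s ^ 2

section Cell

variable {γ : ℝ → ℝ} {n : ℕ}

theorem cell_le (n l : ℕ) : (l : ℝ) / n ≤ ((l + 1 : ℕ) : ℝ) / n := by
  gcongr
  simp

theorem cell_le_one {l : ℕ} (hl : l < n) : ((l + 1 : ℕ) : ℝ) / n ≤ 1 := by
  have : (0 : ℝ) < n := by exact_mod_cast (Nat.zero_le l).trans_lt hl
  rw [div_le_one this]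
  exact_mod_cast hl

theorem intervalIntegrable_cell (hI : IntegrableOn (fun s => γ s ^ 2) (Set.Ioc 0 1)) {l : ℕ}
    (hl : l < n) :
    IntervalIntegrable (fun s => γ s ^ 2) volume ((l : ℝ) / n) (((l + 1 : ℕ) : ℝ) / n) := by
  rw [intervalIntegrable_iff_integrableOn_Ioc_of_le (cell_le n l)]
  exact hI.mono_set (Set.Ioc_subset_Ioc (by positivity) (cell_le_one hl))

theorem sum_cellVariance (hn : 0 < n) (hI : IntegrableOn (fun s => γ s ^ 2) (Set.Ioc 0 1)) :
    ∑ l ∈ Finset.range n, cellVariance γ n l = ∫ s in (0 : ℝ)..1, γ s ^ 2 := by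
  have := intervalIntegral.sum_integral_adjacent_intervals (μ := volume)
    (f := fun s => γ s ^ 2) (a := fun l : ℕ => (l : ℝ) / n) (n := n)
    fun l hl => intervalIntegrable_cell hI hl
  have hn' : (n : ℝ) ≠ 0 := by exact_mod_cast hn.ne'
  simpa [cellVariance, hn'] using this

theorem cell_width (n l : ℕ) :
    ((l + 1 : ℕ) : ℝ) / n - (l : ℝ) / n = 1 / n := by
  push_cast
  ring

theorem abs_cellVariance_sub_le (hI : IntegrableOn (fun s => γ s ^ 2) (Set.Ioc 0 1)) {l : ℕ}
    (hl : l < n) {c η : ℝ}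
    (h : ∀ t ∈ Set.Ioc ((l : ℝ) / n) (((l + 1 : ℕ) : ℝ) / n), |γ t ^ 2 - c| ≤ η) :
    |n * cellVariance γ n l - c| ≤ η := by
  have hn : 0 < n := (Nat.zero_le l).trans_lt hl
  have hn' : (0 : ℝ) < n := by exact_mod_cast hn
  have h1 := intervalIntegral.norm_integral_le_of_norm_le_const (a := (l : ℝ) / n)
    (b := ((l + 1 : ℕ) : ℝ) / n) (f := fun t => γ t ^ 2 - c) (C := η) fun t ht => by
      rw [Set.uIoc_of_le (cell_le n l)] at ht
      exact h t ht
  rw [intervalIntegral.integral_sub (intervalIntegrable_cell hI hl) (by simp),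
    intervalIntegral.integral_const, cell_width, Real.norm_eq_abs, smul_eq_mul,
    abs_of_pos (by positivity : (0 : ℝ) < 1 / n)] at h1
  calc |n * cellVariance γ n l - c| = n * |cellVariance γ n l - 1 / n * c| := by
        rw [← abs_of_pos hn', ← abs_mul, abs_of_pos hn']
        congr 1
        field_simp
    _ ≤ n * (η * (1 / n)) := by gcongr; exact h1
    _ = η := by field_simp

theorem cellVariance_pos (hI : IntegrableOn (fun s => γ s ^ 2) (Set.Ioc 0 1))
    (hγ_pos : ∀ t ∈ Set.Icc (0 : ℝ) 1, 0 < γ t) {l : ℕ} (hl : l < n) : 0 < cellVariance γ n l := by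
  have hn' : (0 : ℝ) < n := by exact_mod_cast (Nat.zero_le l).trans_lt hl
  refine intervalIntegral.intervalIntegral_pos_of_pos_on (intervalIntegrable_cell hI hl)
    (fun t ht => ?_) ?_
  · have h0 : (0 : ℝ) ≤ (l : ℝ) / n := by positivity
    exact pow_pos (hγ_pos t ⟨h0.trans ht.1.le, ht.2.le.trans (cell_le_one hl)⟩) 2
  · gcongr
    simp

theorem cellVariance_le (hI : IntegrableOn (fun s => γ s ^ 2) (Set.Ioc 0 1)) {K : ℝ}
    (hK : ∀ t ∈ Set.Icc (0 : ℝ) 1, γ t ^ 2 ≤ K) {l : ℕ} (hl : l < n) :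
    cellVariance γ n l ≤ K / n := by
  have hn' : (0 : ℝ) < n := by exact_mod_cast (Nat.zero_le l).trans_lt hl
  have h1 := abs_cellVariance_sub_le hI hl (c := K / 2) (η := K / 2) fun t ht => by
    have h0 : (0 : ℝ) ≤ (l : ℝ) / n := by positivity
    have := hK t ⟨h0.trans ht.1.le, ht.2.trans (cell_le_one hl)⟩
    rw [abs_le]
    constructor <;> nlinarith [sq_nonneg (γ t)]
  rw [le_div_iff₀ hn']
  linarith [(abs_le.1 h1).2]

/-- If `γ²` is far from its mean on an interval, then the cell variances are dispersed. -/
theorem le_mul_sum_cellVariance_sq (hI : IntegrableOn (fun s => γ s ^ 2) (Set.Ioc 0 1))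
    {t₀ h η c S : ℝ} (ht₀ : 0 ≤ t₀) (h0 : 0 < h) (h1 : t₀ + h ≤ 1) (hη : 0 < η)
    (hc : 2 * η ≤ |c - S|) (hfar : ∀ t ∈ Set.Icc t₀ (t₀ + h), |γ t ^ 2 - c| ≤ η)
    (hS : S = ∫ s in (0 : ℝ)..1, γ s ^ 2) (hn : 4 / h ≤ n) :
    S ^ 2 + h * η ^ 2 / 2 ≤ n * ∑ l ∈ Finset.range n, cellVariance γ n l ^ 2 := by
  have hn' : (0 : ℝ) < n := (by positivity : (0 : ℝ) < 4 / h).trans_le hn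
  have hnpos : 0 < n := by exact_mod_cast hn'
  have hvar : ∑ l ∈ Finset.range n, (n * cellVariance γ n l - S) ^ 2 =
      n * (n * ∑ l ∈ Finset.range n, cellVariance γ n l ^ 2 - S ^ 2) := by
    have : ∀ l, (n * cellVariance γ n l - S) ^ 2 =
        n ^ 2 * cellVariance γ n l ^ 2 - 2 * n * S * cellVariance γ n l + S ^ 2 := fun l => by ring
    simp only [this, Finset.sum_add_distrib, Finset.sum_sub_distrib, ← Finset.mul_sum,
      sum_cellVariance hnpos hI, ← hS, Finset.sum_const, Finset.card_range, nsmul_eq_mul]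
    ring
  set I := Finset.Ico ⌈n * t₀⌉₊ ⌊n * (t₀ + h)⌋₊ with hIdef
  have hfl : (⌊n * (t₀ + h)⌋₊ : ℝ) ≤ n * (t₀ + h) := Nat.floor_le (by positivity)
  have hsub : I ⊆ Finset.range n := by
    intro l hl
    rw [Finset.mem_range]
    have h2 : (l : ℝ) < n * (t₀ + h) :=
      (Nat.cast_lt.2 (Finset.mem_Ico.1 hl).2).trans_le hfl
    have h3 : (l : ℝ) < n := by nlinarith
    exact_mod_cast h3
  have hterm : ∀ l ∈ I, η ^ 2 ≤ (n * cellVariance γ n l - S) ^ 2 := by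
    intro l hl
    have hl' := Finset.mem_Ico.1 hl
    have h2 : n * t₀ ≤ l := Nat.ceil_le.1 hl'.1
    have h3 : ((l + 1 : ℕ) : ℝ) ≤ n * (t₀ + h) := (Nat.cast_le.2 hl'.2).trans hfl
    have h4 := abs_cellVariance_sub_le hI (Finset.mem_range.1 (hsub hl)) (c := c) (η := η)
      fun t ht => hfar t ⟨((le_div_iff₀' hn').2 h2).trans ht.1.le,
        ht.2.trans ((div_le_iff₀' hn').2 h3)⟩
    have h5 : η ≤ |n * cellVariance γ n l - S| := by
      have h6 := abs_sub_abs_le_abs_sub (c - S) (c - n * cellVariance γ n l)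
      rw [abs_sub_comm c (n * _)] at h6
      have h7 : c - S - (c - n * cellVariance γ n l) = n * cellVariance γ n l - S := by ring
      rw [h7] at h6
      linarith
    rw [← sq_abs (n * cellVariance γ n l - S)]
    gcongr
  have hcard : n * h / 2 ≤ (I.card : ℝ) := by
    rw [hIdef, Nat.card_Ico]
    have h2 : (⌈n * t₀⌉₊ : ℝ) < n * t₀ + 1 := Nat.ceil_lt_add_one (by positivity)
    have h3 : n * (t₀ + h) < (⌊n * (t₀ + h)⌋₊ : ℝ) + 1 := Nat.lt_floor_add_one _
    have h4 : 4 ≤ n * h := by rwa [div_le_iff₀ h0] at hn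
    have h5 : ((⌊n * (t₀ + h)⌋₊ : ℝ) - ⌈n * t₀⌉₊) ≤ ((⌊n * (t₀ + h)⌋₊ - ⌈n * t₀⌉₊ : ℕ) : ℝ) := by
      rw [sub_le_iff_le_add]
      exact_mod_cast le_tsub_add
    nlinarith
  have hsum : n * h / 2 * η ^ 2 ≤ ∑ l ∈ Finset.range n, (n * cellVariance γ n l - S) ^ 2 := by
    calc n * h / 2 * η ^ 2 ≤ I.card * η ^ 2 := by gcongr
      _ = ∑ l ∈ I, η ^ 2 := by rw [Finset.sum_const, nsmul_eq_mul]
      _ ≤ ∑ l ∈ I, (n * cellVariance γ n l - S) ^ 2 := Finset.sum_le_sum hterm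
      _ ≤ _ := Finset.sum_le_sum_of_subset_of_nonneg hsub fun _ _ _ => sq_nonneg _
  rw [hvar] at hsum
  have : n * (h * η ^ 2 / 2) ≤ n * (n * ∑ l ∈ Finset.range n, cellVariance γ n l ^ 2 - S ^ 2) := by
    linarith
  linarith [le_of_mul_le_mul_left this hn']

end Cell

/-! ### The empirical spectral distribution of a weighted Gram matrix -/

theorem esd_eq_one_sub {p : ℕ} (hp : 0 < p) {A : Matrix (Fin p) (Fin p) ℝ} (hA : A.IsHermitian)
    (B : ℝ) :
    esd hA B = 1 - ((Finset.univ.filter fun j => B < hA.eigenvalues j).card : ℝ) / p := by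
  classical
  have hp' : (p : ℝ) ≠ 0 := by exact_mod_cast hp.ne'
  have h := Finset.card_filter_add_card_filter_not (s := (Finset.univ : Finset (Fin p)))
    (fun j => hA.eigenvalues j ≤ B)
  simp only [not_le, Finset.card_univ, Fintype.card_fin] at h
  have h' : (((Finset.univ.filter fun j => hA.eigenvalues j ≤ B).card : ℝ) +
      (Finset.univ.filter fun j => B < hA.eigenvalues j).card) = p := by exact_mod_cast h
  rw [eq_sub_iff_add_eq, esd, ← add_div]
  rw [div_eq_one_iff_eq hp']
  convert h' using 4

theorem esd_le_of_nearly_orthogonal {n p : ℕ} (hn : 0 < n) (hp : 0 < p) {w : Fin n → ℝ}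
    {z : Fin n → Fin p → ℝ} {A : Matrix (Fin p) (Fin p) ℝ} (hA : A.IsHermitian)
    (hx : A = ∑ l, Matrix.vecMulVec (fun j => √(w l) * z l j) fun j => √(w l) * z l j)
    {S K δ δ₀ B : ℝ} (hK : 0 < K) (hw0 : ∀ l, 0 ≤ w l) (hwK : ∀ l, w l ≤ K / n)
    (hS : ∑ l, w l = S) (hw2 : S ^ 2 + δ₀ ≤ n * ∑ l, w l ^ 2) (hδ0 : 0 ≤ δ) (hδ1 : δ ≤ 1)
    (hB : 0 ≤ B)
    (hz : ∀ k, ∑ j, z k j ^ 2 ∈ Set.Icc ((1 - δ) * p) ((1 + δ) * p))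
    (hz' : ∀ k, ∑ l ∈ Finset.univ.erase k, (∑ j, z k j * z l j) ^ 2 ≤ 4 * n * ∑ j, z k j ^ 2)
    (hT : 16 * K * (1 + δ) * S ≤ (1 - δ) ^ 2 * (p / n) * (S ^ 2 + δ₀) - (1 + δ) * S * B) :
    esd hA B ≤ 1 - ((1 - δ) ^ 2 * (p / n) * (S ^ 2 + δ₀) - (1 + δ) * S * B) /
      (4 * (K * (1 + δ) * (p / n)) ^ 2) := by
  have hn' : (0 : ℝ) < n := by exact_mod_cast hn
  have hp' : (0 : ℝ) < p := by exact_mod_cast hp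
  have hS0 : 0 ≤ S := hS ▸ Finset.sum_nonneg fun l _ => hw0 l
  obtain ⟨a, ha, hax⟩ := exists_gram_factor _ hA hx
  have hG : ∀ k l, ∑ i, a k i * a l i = √(w k) * √(w l) * ∑ j, z k j * z l j := by
    intro k l
    rw [hax, Finset.mul_sum]
    exact Finset.sum_congr rfl fun j _ => by ring
  have hGd : ∀ k, ∑ i, a k i * a k i = w k * ∑ j, z k j ^ 2 := by
    intro k
    rw [hG, Real.mul_self_sqrt (hw0 k)]
    simp only [sq]
  have hGo : ∀ k l, (∑ i, a k i * a l i) ^ 2 = w k * w l * (∑ j, z k j * z l j) ^ 2 := by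
    intro k l
    rw [hG, mul_pow, mul_pow, Real.sq_sqrt (hw0 k), Real.sq_sqrt (hw0 l)]
  have hzn : ∀ k, 0 ≤ ∑ j, z k j ^ 2 := fun k => Finset.sum_nonneg fun _ _ => sq_nonneg _
  set T := (1 - δ) ^ 2 * (p / n) * (S ^ 2 + δ₀) - (1 + δ) * S * B with hTdef
  have hT0 : 0 ≤ T := le_trans (by positivity) hT
  have hdiag : ∑ k, ∑ i, a k i * a k i ≤ (1 + δ) * p * S := by
    rw [← hS, Finset.mul_sum]
    refine Finset.sum_le_sum fun k _ => ?_
    rw [hGd, mul_comm]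
    exact mul_le_mul_of_nonneg_right (hz k).2 (hw0 k)
  have hcount := le_card_filter_lt ha (B := B) (D := K * (1 + δ) * (p / n)) (T := p * T) hB
    (by positivity) (by positivity) ?_ ?_ ?_
  · rw [esd_eq_one_sub hp]
    gcongr 1 - ?_
    rw [div_le_div_iff₀ (by positivity) hp']
    linarith
  · intro k
    rw [hGd]
    calc w k * ∑ j, z k j ^ 2 ≤ K / n * ((1 + δ) * p) :=
          mul_le_mul (hwK k) (hz k).2 (hzn k) (by positivity)
      _ = _ := by ring
  · have hrow : ∀ k, ∑ l ∈ Finset.univ.erase k, (∑ i, a k i * a l i) ^ 2 ≤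
        w k * (4 * K * ((1 + δ) * p)) := by
      intro k
      calc _ ≤ ∑ l ∈ Finset.univ.erase k, w k * (K / n) * (∑ j, z k j * z l j) ^ 2 := by
            refine Finset.sum_le_sum fun l _ => ?_
            rw [hGo]
            have := hw0 k
            have := hwK l
            gcongr
        _ = w k * (K / n) * ∑ l ∈ Finset.univ.erase k, (∑ j, z k j * z l j) ^ 2 := by
            rw [Finset.mul_sum]
        _ ≤ w k * (K / n) * (4 * n * ((1 + δ) * p)) := by
            have := hw0 k
            have := (hz k).2
            exact mul_le_mul_of_nonneg_left ((hz' k).trans (by gcongr)) (by positivity)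
        _ = _ := by field_simp
    have hsum := Finset.sum_le_sum fun k (_ : k ∈ Finset.univ) => hrow k
    rw [← Finset.sum_mul, hS] at hsum
    have := mul_le_mul_of_nonneg_left hT hp'.le
    linarith
  · have hsq : (1 - δ) ^ 2 * p ^ 2 * ((S ^ 2 + δ₀) / n) ≤ ∑ k, (∑ i, a k i * a k i) ^ 2 := by
      calc _ ≤ (1 - δ) ^ 2 * p ^ 2 * ∑ k, w k ^ 2 := by
            gcongr
            rwa [div_le_iff₀' hn']
        _ = ∑ k, (w k * ((1 - δ) * p)) ^ 2 := by
            rw [Finset.mul_sum]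
            exact Finset.sum_congr rfl fun k _ => by ring
        _ ≤ _ := by
            refine Finset.sum_le_sum fun k _ => ?_
            rw [hGd]
            have := hw0 k
            have h1 : 0 ≤ 1 - δ := by linarith
            have := (hz k).1
            gcongr
    have e : (p : ℝ) * T = (1 - δ) ^ 2 * p ^ 2 * ((S ^ 2 + δ₀) / n) - B * ((1 + δ) * p * S) := by
      rw [hTdef]
      ring
    rw [e]
    have := mul_le_mul_of_nonneg_left hdiag hB
    linarith

/-! ### The Marčenko–Pastur law -/

/-- A continuous cutoff function which vanishes up to `b` and equals `1` from `b + d` on. -/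
noncomputable def cutoff (b d : ℝ) : ℝ →ᵇ ℝ :=
  BoundedContinuousFunction.ofNormedAddCommGroup (fun x => max 0 (min 1 ((x - b) / d)))
    (by fun_prop) 1 fun x => by
      rw [Real.norm_eq_abs, abs_of_nonneg (le_max_left _ _)]
      exact max_le zero_le_one (min_le_left _ _)

theorem cutoff_apply (b d x : ℝ) : cutoff b d x = max 0 (min 1 ((x - b) / d)) := rfl

theorem cutoff_of_le {b d x : ℝ} (hd : 0 < d) (hx : x ≤ b) : cutoff b d x = 0 := by
  rw [cutoff_apply, max_eq_left]
  exact (min_le_right _ _).trans (div_nonpos_of_nonpos_of_nonneg (by linarith) hd.le)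

theorem cutoff_of_lt {b d x : ℝ} (hd : 0 < d) (hx : b + d < x) : cutoff b d x = 1 := by
  rw [cutoff_apply, min_eq_left, max_eq_right zero_le_one]
  rw [le_div_iff₀ hd]
  linarith

theorem integral_cutoff_marchenkoPastur {y s d : ℝ} (hs : 0 ≤ s) (hd : 0 < d) :
    ∫ x, cutoff (mpRight y s) d x ∂(marchenkoPastur y s) = 0 := by
  refine integral_eq_zero_of_ae ?_
  have hb : 0 ≤ mpRight y s := mul_nonneg hs (sq_nonneg _)
  rw [marchenkoPastur, Filter.EventuallyEq, ae_add_measure_iff]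
  constructor
  · rw [ae_withDensity_iff]
    · refine ae_of_all _ fun x hx => cutoff_of_le hd ?_
      by_contra! hlt
      exact hx (by rw [Set.indicator_of_notMem fun h => absurd h.2 (not_le.2 hlt)]; simp)
    · exact (Measurable.indicator (by fun_prop) measurableSet_Icc).ennreal_ofReal
  · refine Measure.ae_smul_measure ?_ _
    rw [ae_dirac_eq]
    exact cutoff_of_le hd hb

theorem one_sub_esd_le_integral_cutoff {p : ℕ} (hp : 0 < p) {A : Matrix (Fin p) (Fin p) ℝ}
    (hA : A.IsHermitian) {b d : ℝ} (hd : 0 < d) :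
    1 - esd hA (b + d) ≤ ∫ x, cutoff b d x ∂(esdMeasure hA) := by
  rw [esd_eq_one_sub hp, esdMeasure, integral_smul_measure, integral_finsetSum_measure
    fun j _ => (cutoff b d).integrable _]
  simp only [integral_dirac, ENNReal.toReal_inv, ENNReal.toReal_natCast, smul_eq_mul]
  rw [sub_sub_cancel, div_eq_inv_mul]
  gcongr
  rw [Finset.card_filter, Nat.cast_sum]
  refine Finset.sum_le_sum fun j _ => ?_
  split_ifs with h
  · rw [cutoff_of_lt hd h, Nat.cast_one]
  · rw [Nat.cast_zero]
    exact le_max_left _ _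

theorem esd_mem_Icc {p : ℕ} {A : Matrix (Fin p) (Fin p) ℝ} (hA : A.IsHermitian) (x : ℝ) :
    esd hA x ∈ Set.Icc (0 : ℝ) 1 := by
  classical
  refine ⟨div_nonneg (by positivity) (by positivity), div_le_one_of_le₀ ?_ (by positivity)⟩
  exact_mod_cast (Finset.card_le_univ _).trans_eq (Fintype.card_fin p)

/-- Weak convergence to the Marčenko–Pastur law leaves a vanishing proportion of eigenvalues to
the right of its right edge. -/
theorem not_convergesInDistribution_marchenkoPastur {A : (p : ℕ) → Matrix (Fin p) (Fin p) ℝ}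
    (hA : ∀ p, (A p).IsHermitian) {y s d c : ℝ} (hs : 0 ≤ s) (hd : 0 < d) (hc : c < 1)
    (h : ∀ᶠ p in atTop, esd (hA p) (mpRight y s + d) ≤ c) :
    ¬ ConvergesInDistribution (fun p => esdMeasure (hA p)) (marchenkoPastur y s) := by
  intro hconv
  have h1 := hconv (cutoff (mpRight y s) d)
  rw [integral_cutoff_marchenkoPastur hs hd] at h1
  obtain ⟨p, hp, hp1, hp0⟩ := (h.and ((h1.eventually (gt_mem_nhds (sub_pos.2 hc))).and
    (eventually_gt_atTop 0))).exists
  linarith [one_sub_esd_le_integral_cutoff hp0 (hA p) (b := mpRight y s) hd]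

/-! ### The high-dimensional regime -/

theorem exists_tolerance (S : ℝ) {δ₀ : ℝ} (h0 : 0 < δ₀) :
    ∃ δ : ℝ, 0 < δ ∧ δ ≤ 1 ∧ (1 + δ) * S ^ 2 < (1 - δ) ^ 2 * (S ^ 2 + δ₀) := by
  have h : ∀ᶠ δ in 𝓝[>] (0 : ℝ), (1 + δ) * S ^ 2 < (1 - δ) ^ 2 * (S ^ 2 + δ₀) := by
    refine nhdsWithin_le_nhds ?_
    have hc : Continuous fun δ : ℝ => (1 - δ) ^ 2 * (S ^ 2 + δ₀) - (1 + δ) * S ^ 2 := by fun_prop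
    have := (hc.tendsto 0).eventually (lt_mem_nhds (a := 0) (by simp; linarith))
    exact this.mono fun δ hδ => sub_pos.1 hδ
  obtain ⟨δ, h1, h2, h3⟩ := (h.and (Ioc_mem_nhdsGT one_pos)).exists
  exact ⟨δ, h2, h3, h1⟩

theorem exists_critical_ratio {S ε K δ δ₀ : ℝ} (hS : 0 ≤ S) (hε : 0 < ε) (hK : 0 < K) (hδ : 0 < δ)
    (h : (1 + δ) * S ^ 2 < (1 - δ) ^ 2 * (S ^ 2 + δ₀)) :
    ∃ yc : ℝ, 0 < yc ∧ ∀ y, yc ≤ y → 16 * K * (1 + δ) * S <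
      (1 - δ) ^ 2 * y * (S ^ 2 + δ₀) - (1 + δ) * S * (mpRight y S + S * ε) := by
  set κ := (1 - δ) ^ 2 * (S ^ 2 + δ₀) - (1 + δ) * S ^ 2 with hκ
  have hκ0 : 0 < κ := sub_pos.2 h
  set C := (1 + δ) * S ^ 2 * (3 + ε) + 16 * K * (1 + δ) * S with hC
  have hC0 : 0 ≤ C := by positivity
  refine ⟨(1 + C / κ) ^ 2, by positivity, fun y hy => ?_⟩
  have hy0 : 0 ≤ y := (sq_nonneg _).trans hy
  have ht : 1 + C / κ ≤ √y := Real.le_sqrt_of_sq_le hy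
  have ht1 : 1 ≤ √y := le_trans (by linarith [div_nonneg hC0 hκ0.le]) ht
  have h1 : C < κ * √y := by
    have : κ * (1 + C / κ) = κ + C := by field_simp
    nlinarith
  have h2 : C * √y < κ * y := by
    nlinarith [Real.mul_self_sqrt hy0]
  have h3 : (1 + δ) * S ^ 2 * (1 + ε) + 16 * K * (1 + δ) * S ≤
      ((1 + δ) * S ^ 2 * (1 + ε) + 16 * K * (1 + δ) * S) * √y :=
    le_mul_of_one_le_right (by positivity) ht1
  have h4 : (1 + √y) ^ 2 = 1 + 2 * √y + y := by
    rw [add_sq, Real.sq_sqrt hy0]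
    ring
  rw [mpRight, h4]
  have e : (1 - δ) ^ 2 * y * (S ^ 2 + δ₀) - (1 + δ) * S * (S * (1 + 2 * √y + y) + S * ε) -
      16 * K * (1 + δ) * S = κ * y - C * √y + (((1 + δ) * S ^ 2 * (1 + ε) +
      16 * K * (1 + δ) * S) * √y - ((1 + δ) * S ^ 2 * (1 + ε) + 16 * K * (1 + δ) * S)) := by
    rw [hκ, hC]
    ring
  linarith

theorem eventually_bounds_of_tendsto_ratio {n : ℕ → ℕ} {y : ℝ} (hy : 0 < y)
    (hn : Tendsto (fun p : ℕ => (p : ℝ) / (n p : ℝ)) atTop (𝓝 y)) :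
    ∀ᶠ p : ℕ in atTop, 0 < n p ∧ (n p : ℝ) ≤ 2 / y * p ∧ (p : ℝ) / (2 * y) ≤ n p := by
  filter_upwards [hn.eventually (lt_mem_nhds (half_lt_self hy)),
    hn.eventually (gt_mem_nhds (by linarith : y < 2 * y))] with p h1 h2
  have h0 : 0 < n p := by
    by_contra! h
    rw [Nat.le_zero.1 h, Nat.cast_zero, div_zero] at h1
    linarith
  have h0' : (0 : ℝ) < n p := by exact_mod_cast h0
  refine ⟨h0, ?_, ?_⟩
  · rw [lt_div_iff₀ h0'] at h1
    rw [div_mul_eq_mul_div, le_div_iff₀ hy]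
    linarith
  · rw [div_lt_iff₀ h0'] at h2
    rw [div_le_iff₀ (by positivity)]
    linarith

theorem summable_exceptional {n : ℕ → ℕ} {y : ℝ} (hy : 0 < y)
    (hn : Tendsto (fun p : ℕ => (p : ℝ) / (n p : ℝ)) atTop (𝓝 y)) {α : ℝ} (hα : 0 < α) :
    Summable fun p : ℕ => (n p : ℝ) * (2 * Real.exp (-α * p) + Real.exp (-(n p : ℝ) / 2)) := by
  have hs : Summable fun p : ℕ => 2 / y * (2 * ((p : ℝ) ^ 1 * Real.exp (-α * p)) +
      (p : ℝ) ^ 1 * Real.exp (-(1 / (4 * y)) * p)) :=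
    (((Real.summable_pow_mul_exp_neg_nat_mul 1 hα).mul_left 2).add
      (Real.summable_pow_mul_exp_neg_nat_mul 1 (by positivity))).mul_left _
  refine hs.of_norm_bounded_eventually_nat ?_
  filter_upwards [eventually_bounds_of_tendsto_ratio hy hn] with p hp
  rw [Real.norm_of_nonneg (by positivity)]
  have h1 : -(n p : ℝ) / 2 ≤ -(1 / (4 * y)) * p := by
    have := hp.2.2
    have e : -(1 / (4 * y)) * (p : ℝ) = -(p / (2 * y)) / 2 := by
      field_simp
      ring
    rw [e]
    linarith
  calc _ ≤ 2 / y * p * (2 * Real.exp (-α * p) + Real.exp (-(1 / (4 * y)) * p)) := by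
        gcongr
        exact hp.2.1
    _ = _ := by ring

theorem equallySpaced_monotone (n : ℕ) : Monotone (equallySpaced n) := by
  intro k l hkl
  unfold equallySpaced
  gcongr

theorem equallySpaced_self_le_one (n : ℕ) : equallySpaced n n ≤ 1 := div_self_le_one _

theorem setIntegral_equallySpaced (γ : ℝ → ℝ) (n l : ℕ) :
    ∫ s in Set.Ioc (equallySpaced n l : ℝ) (equallySpaced n (l + 1) : ℝ), γ s ^ 2 =
      cellVariance γ n l := by
  rw [cellVariance, intervalIntegral.integral_of_le (cell_le n l)]
  simp [equallySpaced]

section Main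

variable {Ω : Type*} [MeasurableSpace Ω] {P : Measure Ω}

theorem SatisfiesScalarSDE.integrableOn_sq {γ : ℝ → ℝ} {p : ℕ} (hp : 0 < p)
    {W : Fin p → ℝ≥0 → Ω → ℝ} {X : ℝ≥0 → Ω → Fin p → ℝ} (hX : SatisfiesScalarSDE P γ W X) :
    IntegrableOn (fun s => γ s ^ 2) (Set.Ioc 0 1) := by
  have h := (hX ⟨0, hp⟩ 1 le_rfl).1.integrable_sq
  rw [← integrable_indicator_iff measurableSet_Ioc]
  refine h.congr (ae_of_all _ fun s => ?_)
  by_cases hs : s ∈ Set.Ioc (0 : ℝ) 1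
  · simp [hs]
  · simp [hs]

variable [IsProbabilityMeasure P]

/-- Almost surely, the normalized increments are eventually of nearly equal lengths and nearly
orthogonal. -/
theorem ae_eventually_nearly_orthogonal {n : ℕ → ℕ} {y : ℝ} (hy : 0 < y)
    (hn : Tendsto (fun p : ℕ => (p : ℝ) / (n p : ℝ)) atTop (𝓝 y)) {δ : ℝ} (hδ0 : 0 < δ)
    (hδ1 : δ ≤ 1) {Z : (p : ℕ) → Ω → Fin (n p) → Fin p → ℝ}
    (hZ : ∀ᶠ p in atTop, HasLaw (Z p) (gaussianMatrix (n p) p) P) :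
    ∀ᵐ ω ∂P, ∀ᶠ p : ℕ in atTop, ∀ k,
      ∑ j, Z p ω k j ^ 2 ∈ Set.Icc ((1 - δ) * p) ((1 + δ) * p) ∧
      ∑ l ∈ Finset.univ.erase k, (∑ j, Z p ω k j * Z p ω l j) ^ 2 ≤
        4 * (n p : ℝ) * ∑ j, Z p ω k j ^ 2 := by
  set s : (p : ℕ) → Set (Fin (n p) → Fin p → ℝ) := fun p =>
    {z | ∃ k, ∑ j, z k j ^ 2 ∉ Set.Icc ((1 - δ) * (p : ℝ)) ((1 + δ) * p) ∨
      4 * (n p : ℝ) * ∑ j, z k j ^ 2 <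
        ∑ l ∈ Finset.univ.erase k, (∑ j, z k j * z l j) ^ 2} with hs
  have hbound : ∀ᶠ p in atTop, P.real (Z p ⁻¹' s p) ≤
      (n p : ℝ) * (2 * Real.exp (-(δ ^ 2 / 16) * p) + Real.exp (-(n p : ℝ) / 2)) := by
    filter_upwards [hZ] with p hp
    refine ENNReal.toReal_le_of_le_ofReal (by positivity) ?_
    refine (Measure.le_map_apply hp.aemeasurable _).trans ?_
    rw [hp.map_eq]
    exact gaussianMatrix_exceptional_le hδ0.le hδ1
  have hsum : Summable fun p => P.real (Z p ⁻¹' s p) :=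
    (summable_exceptional hy hn (by positivity : 0 < δ ^ 2 / 16)).of_norm_bounded_eventually_nat
      (hbound.mono fun p hp => by rwa [Real.norm_of_nonneg measureReal_nonneg])
  have htsum : ∑' p, P (Z p ⁻¹' s p) ≠ ⊤ := by
    have := hsum.tsum_ofReal_ne_top
    simpa only [ofReal_measureReal (measure_ne_top _ _)] using this
  filter_upwards [ae_eventually_notMem htsum] with ω hω
  filter_upwards [hω] with p hp k
  simp only [hs, Set.mem_preimage, Set.mem_ofPred_eq, not_exists, not_or, not_not, not_lt] at hp
  exact hp k

theorem ae_eventually_esd_le {γ : ℝ → ℝ} (hγ_pos : ∀ t ∈ Set.Icc (0 : ℝ) 1, 0 < γ t)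
    {S K δ δ₀ B y : ℝ} {n₀ : ℕ} (hS : S = ∫ t in (0 : ℝ)..1, γ t ^ 2) (hK : 0 < K)
    (hγK : ∀ t ∈ Set.Icc (0 : ℝ) 1, γ t ^ 2 ≤ K) (hδ0 : 0 < δ) (hδ1 : δ ≤ 1)
    {W : (p : ℕ) → Fin p → ℝ≥0 → Ω → ℝ} {X : (p : ℕ) → ℝ≥0 → Ω → Fin p → ℝ} {n : ℕ → ℕ}
    (hW : ∀ p, IsStandardBrownianMotion P (W p)) (hX : ∀ p, SatisfiesScalarSDE P γ (W p) (X p))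
    (hI : IntegrableOn (fun s => γ s ^ 2) (Set.Ioc 0 1))
    (hδ₀ : ∀ m : ℕ, n₀ ≤ m → S ^ 2 + δ₀ ≤ m * ∑ l ∈ Finset.range m, cellVariance γ m l ^ 2)
    (hn : Tendsto (fun p : ℕ => (p : ℝ) / (n p : ℝ)) atTop (𝓝 y)) (hy : 0 < y) (hB : 0 ≤ B)
    (hyc : 16 * K * (1 + δ) * S < (1 - δ) ^ 2 * y * (S ^ 2 + δ₀) - (1 + δ) * S * B) :
    ∃ c < 1, ∀ᵐ ω ∂P, ∀ᶠ p in atTop,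
      esd (rcv_isHermitian (n p) (equallySpaced (n p)) (fun t => X p t ω)) B ≤ c := by
  set g : ℝ → ℝ := fun r => (1 - δ) ^ 2 * r * (S ^ 2 + δ₀) - (1 + δ) * S * B with hg
  have hgc : Continuous g := by fun_prop
  set q : ℝ → ℝ := fun r => g r / (4 * (K * (1 + δ) * r) ^ 2) with hq
  have hS0 : 0 ≤ S := hS ▸ intervalIntegral.integral_nonneg zero_le_one fun _ _ => sq_nonneg _
  have hgy : 0 < g y := lt_of_le_of_lt (by positivity) hyc
  have hqy : 0 < q y := by positivity
  have hqc : ContinuousAt q y := by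
    refine hgc.continuousAt.div (by fun_prop) (by positivity)
  refine ⟨1 - q y / 2, by linarith, ?_⟩
  have hbd := eventually_bounds_of_tendsto_ratio hy hn
  set Z : (p : ℕ) → Ω → Fin (n p) → Fin p → ℝ := fun p ω l j =>
    (√(cellVariance γ (n p) l))⁻¹ *
      (X p (equallySpaced (n p) (l + 1)) ω j - X p (equallySpaced (n p) l) ω j) with hZdef
  have hZ : ∀ p, HasLaw (Z p) (gaussianMatrix (n p) p) P := by
    intro p
    have h := (hX p).hasLaw_normalized_increments (hW p) (equallySpaced_monotone (n p))
      (equallySpaced_self_le_one (n p)) fun l => by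
        rw [setIntegral_equallySpaced]
        exact cellVariance_pos hI hγ_pos l.2
    simpa only [setIntegral_equallySpaced] using h
  have hlarge : ∀ᶠ p in atTop, n₀ ≤ n p := by
    have h1 : Tendsto (fun p : ℕ => (p : ℝ) / (2 * y)) atTop atTop :=
      tendsto_natCast_atTop_atTop.atTop_div_const (by positivity)
    filter_upwards [hbd, h1.eventually_ge_atTop (n₀ : ℝ)] with p h2 h3
    exact_mod_cast h3.trans h2.2.2
  filter_upwards [ae_eventually_nearly_orthogonal hy hn hδ0 hδ1 (Eventually.of_forall hZ)] with ω hω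
  filter_upwards [hω, hbd, hlarge, eventually_gt_atTop 0,
    hn.eventually (hgc.continuousAt.eventually (lt_mem_nhds hyc)),
    hn.eventually (hqc.eventually (lt_mem_nhds (half_lt_self hqy)))] with p hp h1 h2 h3 h4 h5
  have hn0 := h1.1
  have hw : ∀ l : Fin (n p), 0 < cellVariance γ (n p) l := fun l =>
    cellVariance_pos hI hγ_pos l.2
  refine (esd_le_of_nearly_orthogonal (w := fun l => cellVariance γ (n p) l) (z := Z p ω) (K := K)
    (S := S) (δ := δ) (δ₀ := δ₀) hn0 h3 (rcv_isHermitian _ _ _) ?_ hK (fun l => (hw l).le)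
    (fun l => cellVariance_le hI hγK l.2) ?_ ?_ hδ0.le hδ1 hB (fun k => (hp k).1)
    (fun k => (hp k).2) h4.le).trans ?_
  · rw [rcv, Finset.sum_range]
    refine Finset.sum_congr rfl fun l _ => ?_
    have e : (X p (equallySpaced (n p) (l + 1)) ω - X p (equallySpaced (n p) l) ω) =
        fun j => √(cellVariance γ (n p) l) * Z p ω l j := by
      ext j
      rw [hZdef]
      exact (mul_inv_cancel_left₀ (Real.sqrt_pos.2 (hw l)).ne' _).symm
    rw [e]
  · rw [hS, ← sum_cellVariance hn0 hI, Finset.sum_range]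
  · rw [← Finset.sum_range fun l => cellVariance γ (n p) l ^ 2]
    exact hδ₀ _ h2
  · exact sub_le_sub_left h5.le 1

end Main

theorem proposition3
    (γ : ℝ → ℝ) (hγ : CadlagOnUnitInterval γ)
    (hγ_pos : ∀ t ∈ Set.Icc (0 : ℝ) 1, 0 < γ t)
    (hγ_nonconst : ¬ ∃ c : ℝ, ∀ t ∈ Set.Ico (0 : ℝ) 1, γ t = c)
    (σ : ℝ) (hσ : σ ^ 2 = ∫ t in (0 : ℝ)..1, γ t ^ 2)
    (ε : ℝ) (hε : 0 < ε) :
    ∃ yc : ℝ, 0 < yc ∧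
      ∀ (Ω : Type*) [MeasurableSpace Ω] (P : Measure Ω) [IsProbabilityMeasure P]
        (W : (p : ℕ) → Fin p → ℝ≥0 → Ω → ℝ) (X : (p : ℕ) → ℝ≥0 → Ω → Fin p → ℝ)
        (n : ℕ → ℕ) (y : ℝ),
        (∀ p, IsStandardBrownianMotion P (W p)) →
        (∀ p, SatisfiesScalarSDE P γ (W p) (X p)) →
        Tendsto (fun p : ℕ => (p : ℝ) / (n p : ℝ)) atTop (𝓝 y) →
        yc ≤ y →
        (∀ᵐ ω ∂P,
          limsup (fun p : ℕ =>
            esd (rcv_isHermitian (n p) (equallySpaced (n p)) (fun t => X p t ω))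
              (mpRight y (σ ^ 2) + σ ^ 2 * ε)) atTop < 1) ∧
        (∀ᵐ ω ∂P,
          ¬ ConvergesInDistribution
            (fun p : ℕ =>
              esdMeasure (rcv_isHermitian (n p) (equallySpaced (n p)) (fun t => X p t ω)))
            (marchenkoPastur y (σ ^ 2))) := by
  obtain ⟨K, hK, hγK⟩ := hγ.exists_sq_le
  obtain ⟨t₀, h, η, c, ht₀, h0, h1, hη, hc, hfar⟩ :=
    hγ.exists_interval_sq_far hγ_pos hγ_nonconst (σ ^ 2)
  obtain ⟨δ, hδ0, hδ1, hδ⟩ := exists_tolerance (σ ^ 2) (by positivity : 0 < h * η ^ 2 / 2)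
  obtain ⟨yc, hyc0, hyc⟩ := exists_critical_ratio (sq_nonneg σ) hε hK hδ0 hδ
  refine ⟨yc, hyc0, ?_⟩
  intro Ω _ P _ W X n y hW hX hn hy
  have hI := (hX 1).integrableOn_sq one_pos
  have hσ0 : 0 < σ ^ 2 := by
    rw [hσ]
    refine intervalIntegral.intervalIntegral_pos_of_pos_on ?_
      (fun t ht => pow_pos (hγ_pos t ⟨ht.1.le, ht.2.le⟩) 2) one_pos
    rwa [intervalIntegrable_iff_integrableOn_Ioc_of_le zero_le_one]
  have hB : 0 ≤ mpRight y (σ ^ 2) + σ ^ 2 * ε :=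
    add_nonneg (mul_nonneg hσ0.le (sq_nonneg _)) (by positivity)
  obtain ⟨c', hc', hae⟩ := ae_eventually_esd_le hγ_pos (n₀ := ⌈4 / h⌉₊) hσ hK hγK hδ0 hδ1 hW hX hI
    (fun m hm => le_mul_sum_cellVariance_sq hI ht₀ h0 h1 hη hc hfar hσ (Nat.ceil_le.1 hm)) hn
    (hyc0.trans_le hy) hB (hyc y hy)
  refine ⟨hae.mono fun ω hω => ?_, hae.mono fun ω hω => ?_⟩
  · refine (limsup_le_of_le ?_ hω).trans_lt hc'
    exact isCoboundedUnder_le_of_le atTop (x := 0) fun p => (esd_mem_Icc _ _).1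
  · exact not_convergesInDistribution_marchenkoPastur (fun p => rcv_isHermitian _ _ _) hσ0.le
      (mul_pos hσ0 hε) hc' hω
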